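/- Conventions. Let $G$ be a group generated by finitely many elements $s_1,\dots,s_n$. All actions are left actions. Word problem: $G$ has decidable word problem if there is an algorithm which decides whether a given word in the letters $s_i^{\pm 1}$ represents the identity of $G$. Domino problem: a pattern over a finite alphabet $A$ is a map $p\colon F\to A$ with $F\subset G$ finite (coded by words in the generators), with cylinder $[p]=\{x\in A^G : x|_F=p\}$; $G$ acts on $A^G$ by $(g\cdot x)(h)=x(g^{-1}h)$. $G$ has decidable domino problem if there is an algorithm which, on input a finite alphabet $A$ and a finite set $\mathcal F$ of patterns over $A$, decides whether the subshift of finite type $X_{\mathcal F}=A^G\setminus\bigcup_{g\in G}\bigcup_{p\in\mathcal F}g\cdot[p]$ is nonempty. Effective dynamical systems: a computable metric space is a metric space with a dense sequence whose mutual distances are uniformly computable reals. A basic ball is a ball of rational radius around a point of this sequence. A compact subset $K$ is recursively compact if the finite families of basic balls that cover $K$ are recursively enumerable, and a map from $K$ to the space is computable if the preimages of basic balls are, uniformly, traces on $K$ of recursively enumerable unions of basic balls. An action of $G$ on a nonempty topological space is an effective dynamical system (EDS) if it is topologically conjugate to an action of $G$ by computable maps on a recursively compact subset of a computable metric space. It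 is a zero-dimensional EDS if it is topologically conjugate to an action of $G$ by computable maps on a set $Y\subset\{0,1\}^{\mathbb N}$ which is effectively closed (the complement of the union of the cylinders of a recursively enumerable set of words); here $f\colon Y\to\{0,1\}^{\mathbb N}$ is computable if there is a partial computable map $\varphi$ on words such that, for all $x\in Y$, $\varphi$ is defined on every nonempty prefix of $x$, the cylinders of its values at the successive prefixes are nested, and they intersect in $\{f(x)\}$. A topological factor map is a continuous surjective $G$-equivariant map. An EDS is universal if every EDS of $G$ is a topological factor of it, and a zero-dimensional EDS is universal among the zero-dimensional ones if every zero-dimensional EDS of $G$ is a topological factor of it. Theorem B. Let $G$ be a finitely generated group with decidable word problem. There exists a universal EDS of $G$ if and only if the domino problem of $G$ is decidable. Likewise, there exists a zero-dimensional EDS of $G$ that is universal among the zero-dimensional EDS if and only if the domino problem of $G$ is decidable. -/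

import Mathlib

namespace EffDyn

/-! ### Words in generators, the word problem and the domino problem -/

/-- Words in the letters `0, …, n - 1` and their formal inverses (`true` marks the letter itself,
`false` its inverse). -/
abbrev GenWord (n : ℕ) : Type := List (Fin n × Bool)

/-- The group element represented by a word, when the letter `i` stands for `s i`. -/
def wordValue {G : Type*} [Group G] {n : ℕ} (s : Fin n → G) (w : GenWord n) : G :=
  (w.map fun c => if c.2 then s c.1 else (s c.1)⁻¹).prod

/-- The word problem with respect to the generators `s` is a decidable language. -/
def DecidableWordProblem {G : Type*} [Group G] {n : ℕ} (s : Fin n → G) : Prop :=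
  ComputablePred fun w : GenWord n => wordValue s w = 1

/-- A coded pattern with finite support: a finite list of pairs (word, letter). The pair `(w, a)`
prescribes the letter `a` at the group element represented by `w`. -/
abbrev PatternCode (n : ℕ) : Type := List (GenWord n × ℕ)

/-- The cylinder set of a coded pattern in `A ^ G`, with `A = {0, …, k - 1}`.
(A code that prescribes two letters at one element, or a letter outside of `A`, has an empty
cylinder; forbidding it is no constraint.) -/
def patternCylinder {G : Type*} [Group G] {n : ℕ} (s : Fin n → G) (k : ℕ) (p : PatternCode n) :
    Set (G → Fin k) :=
  {x | ∀ c ∈ p, (x (wordValue s c.1) : ℕ) = c.2}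

/-- The left shift `(g · x)(h) = x(g⁻¹ h)` on `A ^ G`. -/
def leftShift {G A : Type*} [Group G] (g : G) (x : G → A) : G → A := fun h => x (g⁻¹ * h)

/-- The subshift of finite type over the alphabet `{0, …, k - 1}` that is given by a finite list of
forbidden patterns: the complement of the union of all translates of their cylinders. -/
def sft {G : Type*} [Group G] {n : ℕ} (s : Fin n → G) (k : ℕ) (P : List (PatternCode n)) :
    Set (G → Fin k) :=
  (⋃ g : G, ⋃ p ∈ P, leftShift g '' patternCylinder s k p)ᶜ

/-- There is an algorithm which, on input an alphabet size and a finite list of patterns over that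
alphabet, decides whether the subshift of finite type they define is nonempty. -/
def DecidableDominoProblem {G : Type*} [Group G] {n : ℕ} (s : Fin n → G) : Prop :=
  ComputablePred fun t : ℕ × List (PatternCode n) => (sft s t.1 t.2).Nonempty

/-! ### Topological dynamics -/

/-- A topological factor map: a continuous, surjective and equivariant map. -/
def IsFactorMap (G : Type*) {X Y : Type*} [Group G] [TopologicalSpace X] [TopologicalSpace Y]
    [MulAction G X] [MulAction G Y] (f : X → Y) : Prop :=
  Continuous f ∧ Function.Surjective f ∧ ∀ (g : G) (x : X), f (g • x) = g • f x

/-- Topological conjugacy of two actions: there is an equivariant homeomorphism. -/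
def Conjugate (G X Y : Type*) [Group G] [TopologicalSpace X] [TopologicalSpace Y]
    [MulAction G X] [MulAction G Y] : Prop :=
  ∃ e : X ≃ₜ Y, ∀ (g : G) (x : X), e (g • x) = g • e x

/-! ### Computability on the Cantor space, and zero-dimensional EDS -/

/-- The initial word `x 0 ⋯ x (m - 1)` of length `m`. -/
def initialWord (x : ℕ → Bool) (m : ℕ) : List Bool := (List.range m).map x

/-- The cylinder set of all sequences which begin with `w`. -/
def cylinder (w : List Bool) : Set (ℕ → Bool) := {x | initialWord x w.length = w}

/-- `Y` is the complement of the union of the cylinders of a recursively enumerable language. -/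
def EffectivelyClosed (Y : Set (ℕ → Bool)) : Prop :=
  ∃ L : List Bool → Prop, REPred L ∧ Y = (⋃ w ∈ {w | L w}, cylinder w)ᶜ

/-- `f : Y → {0,1}^ℕ` is computable: some partial computable map `φ` on words is defined on all the
words `x|_{0, …, m}` with `x ∈ Y`, the cylinders of its values at these words are nested, and they
intersect in `{f x}`. -/
def ComputableCantorMap {Y : Set (ℕ → Bool)} (f : Y → (ℕ → Bool)) : Prop :=
  ∃ φ : List Bool →. List Bool, Partrec φ ∧
    ∀ x : Y, ∃ v : ℕ → List Bool,
      (∀ m, v m ∈ φ (initialWord (x : ℕ → Bool) (m + 1))) ∧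
      Antitone (fun m => cylinder (v m)) ∧
      ⋂ m, cylinder (v m) = {f x}

/-- A zero-dimensional effective dynamical system: an action that is topologically conjugate to an
action by computable maps on an effectively closed subset of the Cantor space. -/
def IsZeroDimEDS (G X : Type*) [Group G] [TopologicalSpace X] [MulAction G X] : Prop :=
  ∃ (Y : Set (ℕ → Bool)) (_ : MulAction G Y),
    EffectivelyClosed Y ∧
    (∀ g : G, ComputableCantorMap fun y : Y => ((g • y : Y) : ℕ → Bool)) ∧
    Conjugate G X Y

/-! ### Computable metric spaces, and general EDS -/

/-- A computable metric space: a metric space with a dense sequence, the distances between whose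
terms are uniformly computable real numbers. -/
class ComputableMetricSpace (M : Type*) extends MetricSpace M where
  /-- the dense sequence -/
  pt : ℕ → M
  dense_pt : DenseRange pt
  computable_dist : ∃ q : ℕ × ℕ × ℕ → ℕ, Computable q ∧
    ∀ i j k : ℕ, |dist (pt i) (pt j) - (q (i, j, k) : ℝ) / 2 ^ k| ≤ 1 / 2 ^ k

/-- The basic open ball with index `(i, a, b)`: its center is the `i`-th point of the dense sequence
and its radius is the rational number `a / (b + 1)`. -/
def basicBall (M : Type*) [ComputableMetricSpace M] (c : ℕ × ℕ × ℕ) : Set M :=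
  Metric.ball (ComputableMetricSpace.pt c.1) ((c.2.1 : ℝ) / ((c.2.2 : ℝ) + 1))

/-- `K` is compact, and the finite lists of basic balls that cover `K` are recursively
enumerable. -/
def RecursivelyCompact {M : Type*} [ComputableMetricSpace M] (K : Set M) : Prop :=
  IsCompact K ∧
    REPred fun l : List (ℕ × ℕ × ℕ) => K ⊆ ⋃ c ∈ l, basicBall M c

/-- `f : K → M` is computable: uniformly in `c`, the preimage of the basic ball with index `c` is
the trace on `K` of a recursively enumerable union of basic balls. -/
def ComputableMetricMap {M : Type*} [ComputableMetricSpace M] {K : Set M} (f : K → M) : Prop :=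
  ∃ E : (ℕ × ℕ × ℕ) × (ℕ × ℕ × ℕ) → Prop, REPred E ∧
    ∀ (c : ℕ × ℕ × ℕ) (x : K),
      f x ∈ basicBall M c ↔ ∃ d : ℕ × ℕ × ℕ, E (c, d) ∧ (x : M) ∈ basicBall M d

/-- An effective dynamical system: an action that is topologically conjugate to an action by
computable maps on a recursively compact subset of a computable metric space. -/
def IsEDS (G X : Type*) [Group G] [TopologicalSpace X] [MulAction G X] : Prop :=
  ∃ (M : Type) (_ : ComputableMetricSpace M) (K : Set M) (_ : MulAction G K),
    RecursivelyCompact K ∧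
    (∀ g : G, ComputableMetricMap fun y : K => ((g • y : K) : M)) ∧
    Conjugate G X K

/-! ### Universality -/

/-- `U` is a (nonempty) EDS of which every (nonempty) EDS is a topological factor. -/
def IsUniversalEDS (G : Type*) (U : Type) [Group G] [TopologicalSpace U] [MulAction G U] : Prop :=
  Nonempty U ∧ IsEDS G U ∧
    ∀ (X : Type) [TopologicalSpace X] [MulAction G X], Nonempty X → IsEDS G X →
      ∃ f : U → X, IsFactorMap G f

/-- `U` is a (nonempty) zero-dimensional EDS of which every (nonempty) zero-dimensional EDS is a
topological factor. -/
def IsUniversalZeroDimEDS (G : Type*) (U : Type) [Group G] [TopologicalSpace U] [MulAction G U] :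
    Prop :=
  Nonempty U ∧ IsZeroDimEDS G U ∧
    ∀ (X : Type) [TopologicalSpace X] [MulAction G X], Nonempty X → IsZeroDimEDS G X →
      ∃ f : U → X, IsFactorMap G f

end EffDyn

/-! ### A calculus of recursively enumerable predicates -/

namespace EffDyn

open Encodable

-- The proof passes through binary systems: sets of configurations in ({0,1}^ℕ)^G in which no
-- translate of a pattern from a set P occurs (`binSystem`). For finite P their nonemptiness problem
-- is the domino problem in another coding (`decidableDominoProblem_iff`). For recursively
-- enumerable P and decidable word problem they are zero-dimensional EDS (`isZeroDimEDS_binSet`),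
-- and every EDS is a factor of one of them (`IsEDS.exists_binSystem_factor`): the bits record where
-- the orbit of a point lies relative to the basic balls, and a pattern is forbidden when it
-- excludes every point of the compact set. Both universality statements therefore reduce to
-- factoring onto nonempty binary systems.
--
-- From a universal system to the domino problem: emptiness of a binary system is semi-decidable by
-- compactness (`rePred_binSystem_eq_empty`). If it is nonempty, a factor map from the universal
-- system pulls the bits at the identity back to clopen partitions, and finite lists of basic balls
-- approximate these. Recursive compactness makes such a list a verifiable certificate
-- (`exists_certifies`, `rePred_certifies`); conversely, any certificate turns the orbit of an
-- arbitrary point into a configuration (`Certifies.nonempty`).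
--
-- From the domino problem to a universal system: the product of all binary systems would do, were
-- it not for the empty ones. With a decision procedure at hand, each recursively enumerable set of
-- patterns is thinned out greedily: a pattern is accepted only if the finite list accepted so far
-- keeps a nonempty system. By compactness all resulting systems are nonempty, those that were
-- nonempty do not change, and their product is one binary system that projects onto each of them
-- (`exists_universal_binSystem`).

attribute [fun_prop] Primrec

/-! ### Primitive recursiveness of terms, for automation. -/

section PrimrecProp

variable {α β γ : Type*} [Primcodable α] [Primcodable β] [Primcodable γ]

@[fun_prop] theorem primrec_id' : Primrec fun a : α => a := Primrec.id

@[fun_prop] theorem primrec_const' (b : β) : Primrec fun _ : α => b := Primrec.const b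

@[fun_prop] theorem primrec_comp' {f : β → γ} {g : α → β} (hf : Primrec f) (hg : Primrec g) :
    Primrec fun a => f (g a) := hf.comp hg

@[fun_prop] theorem primrec_fst' {f : α → β × γ} (hf : Primrec f) : Primrec fun a => (f a).1 :=
  Primrec.fst.comp hf

@[fun_prop] theorem primrec_snd' {f : α → β × γ} (hf : Primrec f) : Primrec fun a => (f a).2 :=
  Primrec.snd.comp hf

@[fun_prop] theorem primrec_pair' {f : α → β} {g : α → γ} (hf : Primrec f) (hg : Primrec g) :
    Primrec fun a => (f a, g a) := hf.pair hg

@[fun_prop] theorem primrec_add' {f g : α → ℕ} (hf : Primrec f) (hg : Primrec g) :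
    Primrec fun a => f a + g a := Primrec.nat_add.comp hf hg

@[fun_prop] theorem primrec_mul' {f g : α → ℕ} (hf : Primrec f) (hg : Primrec g) :
    Primrec fun a => f a * g a := Primrec.nat_mul.comp hf hg

@[fun_prop] theorem primrec_append' {f g : α → List β} (hf : Primrec f) (hg : Primrec g) :
    Primrec fun a => f a ++ g a := Primrec.list_append.comp hf hg

@[fun_prop] theorem primrec_cons' {f : α → β} {g : α → List β} (hf : Primrec f)
    (hg : Primrec g) : Primrec fun a => f a :: g a := Primrec.list_cons.comp hf hg

@[fun_prop] theorem primrec_encode' {f : α → β} (hf : Primrec f) :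
    Primrec fun a => encode (f a) := Primrec.encode.comp hf

@[fun_prop] theorem primrec_length' {f : α → List β} (hf : Primrec f) :
    Primrec fun a => (f a).length := Primrec.list_length.comp hf

@[fun_prop] theorem primrec_some' {f : α → β} (hf : Primrec f) :
    Primrec fun a => some (f a) := Primrec.option_some.comp hf

@[fun_prop] theorem primrec_getElem?' {f : α → List β} {g : α → ℕ} (hf : Primrec f)
    (hg : Primrec g) : Primrec fun a => (f a)[g a]? := Primrec.list_getElem?.comp hf hg

end PrimrecProp

variable {α β : Type*} [Primcodable α] [Primcodable β]

/-- Running a code with a bounded amount `k` of fuel is primitive recursive. This normal form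
reduces the closure properties below to primitive recursive bookkeeping. -/
theorem _root_.REPred.exists_primrec {p : α → Prop} (hp : REPred p) :
    ∃ f : α → ℕ → Bool, Primrec₂ f ∧ ∀ a, p a ↔ ∃ k, f a k = true := by
  obtain ⟨c, hc⟩ := Nat.Partrec.Code.exists_code.1 hp
  refine ⟨fun a k => (Nat.Partrec.Code.evaln k c (encode a)).isSome, ?_, fun a => ?_⟩
  · exact Primrec.option_isSome.comp (Nat.Partrec.Code.primrec_evaln.comp
      ((Primrec.snd.pair (Primrec.const c)).pair (Primrec.encode.comp Primrec.fst)))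
  · have h : (Nat.Partrec.Code.eval c (encode a)).Dom ↔ p a := by
      rw [hc]; simp [Part.assert]
    rw [← h, Part.dom_iff_mem]
    simp only [Nat.Partrec.Code.evaln_complete, Option.isSome_iff_exists, Option.mem_def]
    exact exists_comm

theorem _root_.REPred.of_computable {f : α → ℕ → Bool} (hf : Computable₂ f) :
    REPred fun a => ∃ k, f a k = true := by
  refine (Partrec.dom_re (Partrec.rfind (p := fun a k => Part.some (f a k)) hf.partrec₂)).of_eq
    fun a => ?_
  refine Nat.rfind_dom.trans ⟨fun ⟨k, hk, _⟩ => ⟨k, (Part.mem_some_iff.1 hk).symm⟩, ?_⟩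
  rintro ⟨k, hk⟩
  exact ⟨k, Part.mem_some_iff.2 hk.symm, fun _ => trivial⟩

theorem _root_.REPred.comp {p : β → Prop} (hp : REPred p) {f : α → β} (hf : Computable f) :
    REPred fun a => p (f a) :=
  Partrec.comp hp hf

theorem _root_.REPred.comp' {p : β → Prop} (hp : REPred p) {f : α → β} (hf : Primrec f) :
    REPred fun a => p (f a) :=
  hp.comp hf.to_comp

theorem _root_.REPred.of_primrec {p : α → Prop} (hp : PrimrecPred p) : REPred p :=
  hp.computablePred.to_re

theorem _root_.REPred.eq {f g : α → β} (hf : Primrec f) (hg : Primrec g) :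
    REPred fun a => f a = g a := by
  classical
  exact .of_primrec (Primrec.eq.comp hf hg)

theorem _root_.REPred.lt {f g : α → ℕ} (hf : Primrec f) (hg : Primrec g) :
    REPred fun a => f a < g a := .of_primrec (Primrec.nat_lt.comp hf hg)

theorem _root_.REPred.le {f g : α → ℕ} (hf : Primrec f) (hg : Primrec g) :
    REPred fun a => f a ≤ g a := .of_primrec (Primrec.nat_le.comp hf hg)

/-- Dovetailing: a single number codes both a candidate `b` and the fuel spent on it. Numbers that
code no `b` count as failures. -/
theorem _root_.REPred.exists {p : α → β → Prop} (hp : REPred fun c : α × β => p c.1 c.2) :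
    REPred fun a => ∃ b, p a b := by
  obtain ⟨f, hf, h⟩ := hp.exists_primrec
  have : Computable₂ fun (a : α) (k : ℕ) =>
      ((decode (α := β) k.unpair.1).map fun b => f (a, b) k.unpair.2).getD false := by
    refine Primrec.to_comp ?_
    refine Primrec.option_getD.comp (Primrec.option_map
      (Primrec.decode.comp (Primrec.fst.comp (Primrec.unpair.comp Primrec.snd))) ?_)
      (Primrec.const false)
    exact hf.comp (by fun_prop)
      ((Primrec.snd.comp (Primrec.unpair.comp (Primrec.snd.comp Primrec.fst))))
  refine (REPred.of_computable this).of_eq fun a => ⟨?_, ?_⟩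
  · rintro ⟨k, hk⟩
    cases hb : decode (α := β) k.unpair.1 with
    | none => simp [hb] at hk
    | some b => exact ⟨b, (h (a, b)).2 ⟨k.unpair.2, by simpa [hb] using hk⟩⟩
  · rintro ⟨b, hb⟩
    obtain ⟨k, hk⟩ := (h (a, b)).1 hb
    exact ⟨Nat.pair (encode b) k, by simpa using hk⟩

theorem _root_.REPred.exists' {p : α × β → Prop} (hp : REPred p) :
    REPred fun a => ∃ b, p (a, b) := hp.exists (p := fun a b => p (a, b))

theorem _root_.REPred.and {p q : α → Prop} (hp : REPred p) (hq : REPred q) :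
    REPred fun a => p a ∧ q a := by
  obtain ⟨f, hf, h⟩ := hp.exists_primrec
  obtain ⟨g, hg, h'⟩ := hq.exists_primrec
  have : REPred fun c : α × (ℕ × ℕ) => (f c.1 c.2.1 && g c.1 c.2.2) = true :=
    .eq (Primrec.and.comp (hf.comp (by fun_prop) (by fun_prop))
      (hg.comp (by fun_prop) (by fun_prop))) (by fun_prop)
  refine this.exists'.of_eq fun a => ?_
  simp [h, h']

theorem _root_.REPred.or {p q : α → Prop} (hp : REPred p) (hq : REPred q) :
    REPred fun a => p a ∨ q a := by
  obtain ⟨f, hf, h⟩ := hp.exists_primrec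
  obtain ⟨g, hg, h'⟩ := hq.exists_primrec
  have : REPred fun c : α × ℕ => (f c.1 c.2 || g c.1 c.2) = true :=
    .eq (Primrec.or.comp (hf.comp (by fun_prop) (by fun_prop))
      (hg.comp (by fun_prop) (by fun_prop))) (by fun_prop)
  refine this.exists'.of_eq fun a => ?_
  simp [h, h', exists_or]

theorem _root_.REPred.forall_mem {p : α → β → Prop} (hp : REPred fun c : α × β => p c.1 c.2)
    {l : α → List β} (hl : Primrec l) : REPred fun a => ∀ b ∈ l a, p a b := by
  obtain ⟨f, hf, h⟩ := hp.exists_primrec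
  have h1 : PrimrecRel fun (k : ℕ) (c : α × β) => ∃ i < k, f c i = true := by
    have h0 : PrimrecRel fun (i : ℕ) (c : α × β) => f c i = true :=
      Primrec.eq.comp (hf.comp Primrec.snd Primrec.fst) (Primrec.const true)
    exact (h0.exists_mem_list.comp (f := fun c : ℕ × (α × β) => List.range c.1)
      (g := fun c => c.2) (Primrec.list_range.comp (by fun_prop)) (by fun_prop)).of_eq
      fun c => by simp
  have h2 : PrimrecRel fun (b : β) (c : ℕ × α) => ∃ i < c.1, f (c.2, b) i = true :=
    h1.comp (f := fun x : β × (ℕ × α) => x.2.1) (g := fun x => (x.2.2, x.1))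
      (by fun_prop) (by fun_prop)
  have h3 : PrimrecPred fun c : α × ℕ => ∀ b ∈ l c.1, ∃ i < c.2, f (c.1, b) i = true :=
    h2.forall_mem_list.comp (f := fun c : α × ℕ => l c.1) (g := fun c => (c.2, c.1))
      (by fun_prop) (by fun_prop)
  refine (REPred.of_primrec h3).exists'.of_eq fun a => ⟨?_, fun H => ?_⟩
  · rintro ⟨k, hk⟩ b hb
    obtain ⟨i, -, hi⟩ := hk b hb
    exact (h (a, b)).2 ⟨i, hi⟩
  · have : ∀ b ∈ l a, ∃ i, f (a, b) i = true := fun b hb => (h (a, b)).1 (H b hb)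
    change ∃ k, ∀ b ∈ l a, ∃ i < k, f (a, b) i = true
    generalize l a = t at this ⊢
    induction t with
    | nil => exact ⟨0, by simp⟩
    | cons b t ih =>
      obtain ⟨k, hk⟩ := ih fun c hc => this c (by simp [hc])
      obtain ⟨i, hi⟩ := this b (by simp)
      refine ⟨max k (i + 1), fun c hc => ?_⟩
      rcases List.mem_cons.1 hc with rfl | hc
      · exact ⟨i, by omega, hi⟩
      · obtain ⟨j, hj, hj'⟩ := hk c hc
        exact ⟨j, by omega, hj'⟩

theorem _root_.REPred.mem {f : α → β} {l : α → List β} (hf : Primrec f) (hl : Primrec l) :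
    REPred fun a => f a ∈ l a := by
  have : REPred fun c : α × ℕ => (l c.1)[c.2]? = some (f c.1) := .eq (by fun_prop) (by fun_prop)
  exact this.exists'.of_eq fun a => by rw [List.mem_iff_getElem?]

theorem _root_.REPred.exists_mem {p : α → β → Prop} (hp : REPred fun c : α × β => p c.1 c.2)
    {l : α → List β} (hl : Primrec l) : REPred fun a => ∃ b ∈ l a, p a b :=
  ((REPred.mem (f := fun c : α × β => c.2) (l := fun c => l c.1) (by fun_prop)
    (by fun_prop)).and hp).exists

/-- Finitely many recursively enumerable predicates are uniformly so. -/
theorem _root_.REPred.of_forall_finite {ι : Type*} [Primcodable ι] [Finite ι] {p : ι → α → Prop}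
    (hp : ∀ i, REPred (p i)) : REPred fun c : ι × α => p c.1 c.2 := by
  classical
  have : ∀ t : Finset ι, REPred fun c : ι × α => c.1 ∈ t ∧ p c.1 c.2 := by
    intro t
    induction t using Finset.induction with
    | empty => exact (REPred.lt (f := fun _ => 0) (g := fun _ => 0) (by fun_prop)
        (by fun_prop)).of_eq (by simp)
    | insert i t hi ih =>
      refine (((REPred.eq (f := fun c : ι × α => c.1) (g := fun _ => i) (by fun_prop)
        (by fun_prop)).and ((hp i).comp' (f := fun c : ι × α => c.2) (by fun_prop))).or ih).of_eq
        fun c => ?_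
      simp only [Finset.mem_insert, or_and_right]
      refine or_congr_left (and_congr_right fun h => by rw [h])
  cases nonempty_fintype ι
  exact (this Finset.univ).of_eq (by simp)

end EffDyn

/-! ### Recursive enumerability over the Cantor space -/

namespace EffDyn

open Encodable Topology

theorem length_initialWord (x : ℕ → Bool) (m : ℕ) : (initialWord x m).length = m := by
  simp [initialWord]

theorem initialWord_eq_iff {x y : ℕ → Bool} {m : ℕ} :
    initialWord x m = initialWord y m ↔ ∀ i < m, x i = y i := by
  simp [initialWord, List.map_inj_left]

theorem take_initialWord (x : ℕ → Bool) (m N : ℕ) :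
    (initialWord x N).take m = initialWord x (min m N) := by
  simp [initialWord, ← List.map_take, List.take_range]

theorem getElem?_initialWord_eq_some {x : ℕ → Bool} {m i : ℕ} {b : Bool} :
    (initialWord x m)[i]? = some b ↔ i < m ∧ x i = b := by
  by_cases h : i < m <;> simp [initialWord, h]

/-- The sequence that extends a word by zeros. -/
def padWord (w : List Bool) : ℕ → Bool := fun j => w.getD j false

theorem initialWord_padWord (w : List Bool) : initialWord (padWord w) w.length = w := by
  apply List.ext_getElem
  · simp [initialWord]
  · intro i h1 h2
    simp [initialWord, padWord, h2]

theorem isOpen_setOf_initialWord (S : List Bool → Prop) (m : ℕ) :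
    IsOpen {x : ℕ → Bool | S (initialWord x m)} := by
  rw [isOpen_iff_mem_nhds]
  intro x hx
  have : ∀ᶠ y in 𝓝 x, ∀ i ∈ Finset.range m, y i = x i := by
    rw [Finset.eventually_all]
    intro i _
    exact (continuous_apply (A := fun _ : ℕ => Bool) i).continuousAt
      ((isOpen_discrete {x i}).mem_nhds rfl)
  filter_upwards [this] with y hy
  have : initialWord y m = initialWord x m :=
    initialWord_eq_iff.2 fun i hi => hy i (Finset.mem_range.2 hi)
  simpa [this] using hx

theorem exists_bound_of_forall_cantor {S : List Bool → Prop}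
    (h : ∀ x : ℕ → Bool, ∃ m, S (initialWord x m)) :
    ∃ N, ∀ x : ℕ → Bool, ∃ m ≤ N, S (initialWord x m) := by
  have hd : Directed (· ⊆ ·) fun N : ℕ => ⋃ m ≤ N, {x : ℕ → Bool | S (initialWord x m)} := by
    refine Monotone.directed_le fun a b hab => ?_
    exact Set.biUnion_subset_biUnion_left fun m hm => le_trans hm hab
  obtain ⟨N, hN⟩ := isCompact_univ.elim_directed_cover _
    (fun N => isOpen_iUnion fun m => isOpen_iUnion fun _ => isOpen_setOf_initialWord S m)
    (fun x _ => by
      obtain ⟨m, hm⟩ := h x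
      simp only [Set.mem_iUnion]
      exact ⟨m, m, le_rfl, hm⟩) hd
  refine ⟨N, fun x => ?_⟩
  have := hN (Set.mem_univ x)
  simpa using this

/-- All words of a given length. -/
def allWords (N : ℕ) : List (List Bool) :=
  N.rec [[]] fun _ l => l.map (fun v => v ++ [false]) ++ l.map (fun v => v ++ [true])

theorem primrec_allWords : Primrec allWords := by
  refine Primrec.nat_rec₁ _ (Primrec.list_append.comp ?_ ?_)
  · exact Primrec.list_map Primrec.snd (by unfold Primrec₂; fun_prop)
  · exact Primrec.list_map Primrec.snd (by unfold Primrec₂; fun_prop)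

theorem mem_allWords {N : ℕ} {v : List Bool} :
    v ∈ allWords N ↔ ∃ x, initialWord x N = v := by
  have h : ∀ v : List Bool, v ∈ allWords N ↔ v.length = N := by
    induction N with
    | zero => simp [allWords]
    | succ N ih =>
      intro v
      have e : allWords (N + 1) = (allWords N).map (fun v => v ++ [false]) ++
        (allWords N).map (fun v => v ++ [true]) := rfl
      rw [e]
      simp only [List.mem_append, List.mem_map, ih]
      constructor
      · rintro (⟨u, rfl, rfl⟩ | ⟨u, rfl, rfl⟩) <;> simp
      · intro hv
        have hne : v ≠ [] := by rintro rfl; simp at hv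
        have hl : v.dropLast.length = N := by simp [hv]
        cases hb : v.getLast hne
        · exact Or.inl ⟨_, hl, by rw [← hb]; exact List.dropLast_append_getLast hne⟩
        · exact Or.inr ⟨_, hl, by rw [← hb]; exact List.dropLast_append_getLast hne⟩
  rw [h]
  constructor
  · rintro rfl
    exact ⟨_, initialWord_padWord v⟩
  · rintro ⟨x, rfl⟩
    exact length_initialWord x N

/-- By compactness a single length `N` serves all sequences, so it suffices to search for `N` and
check the finitely many words of that length. This is the source of semi-decidability for covers and
for emptiness. -/
theorem _root_.REPred.forall_cantor {α : Type*} [Primcodable α] {S : α → List Bool → Prop}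
    (hS : REPred fun c : α × List Bool => S c.1 c.2) :
    REPred fun a => ∀ x : ℕ → Bool, ∃ m, S a (initialWord x m) := by
  have h1 : REPred fun c : (α × ℕ) × List Bool => ∃ m, S c.1.1 (c.2.take m) := by
    refine REPred.exists (p := fun (c : (α × ℕ) × List Bool) m => S c.1.1 (c.2.take m)) ?_
    exact hS.comp' (f := fun c : ((α × ℕ) × List Bool) × ℕ => (c.1.1.1, c.1.2.take c.2))
      (Primrec.pair (by fun_prop) (Primrec.list_take.comp (by fun_prop) (by fun_prop)))
  have h2 : REPred fun c : α × ℕ => ∀ v ∈ allWords c.2, ∃ m, S c.1 (v.take m) :=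
    h1.forall_mem (p := fun (c : α × ℕ) v => ∃ m, S c.1 (v.take m))
      (primrec_allWords.comp Primrec.snd)
  refine h2.exists'.of_eq fun a => ⟨?_, fun h => ?_⟩
  · rintro ⟨N, hN⟩ x
    obtain ⟨m, hm⟩ := hN _ (mem_allWords.2 ⟨x, rfl⟩)
    exact ⟨_, by simpa only [take_initialWord] using hm⟩
  · obtain ⟨N, hN⟩ := exists_bound_of_forall_cantor h
    refine ⟨N, fun v hv => ?_⟩
    obtain ⟨x, rfl⟩ := mem_allWords.1 hv
    obtain ⟨m, hm, hm'⟩ := hN x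
    exact ⟨m, by simpa only [take_initialWord, min_eq_left hm] using hm'⟩

/-! ### The Cantor space as a computable metric space -/

@[fun_prop] theorem primrec_two_pow' {α : Type*} [Primcodable α] {f : α → ℕ} (hf : Primrec f) :
    Primrec fun a => 2 ^ f a :=
  (Primrec₂.unpaired'.1 Nat.Primrec.pow : Primrec₂ fun a b : ℕ => a ^ b).comp
    (Primrec.const 2) hf

/-- A dense sequence in the Cantor space. -/
def cantorPoint (i : ℕ) : ℕ → Bool := padWord ((decode (α := List Bool) i).getD [])

theorem cantorPoint_encode (w : List Bool) : cantorPoint (encode w) = padWord w := by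
  simp [cantorPoint]

@[fun_prop] theorem primrec_initialWord_cantorPoint {α : Type*} [Primcodable α] {f g : α → ℕ}
    (hf : Primrec f) (hg : Primrec g) : Primrec fun a => initialWord (cantorPoint (f a)) (g a) := by
  have : Primrec₂ fun i m : ℕ => initialWord (cantorPoint i) m := by
    unfold initialWord cantorPoint padWord
    refine Primrec.list_map (Primrec.list_range.comp Primrec.snd) ?_
    refine (Primrec.list_getD false).comp (Primrec.option_getD.comp (Primrec.decode.comp ?_) ?_) ?_
      <;> fun_prop
  exact this.comp hf hg

/-- The numerators of dyadic approximations of the distances between the points of the dense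
sequence. -/
def cantorDist (i j k : ℕ) : ℕ :=
  k.rec 1 fun m r =>
    if initialWord (cantorPoint i) (m + 1) = initialWord (cantorPoint j) (m + 1) then 1 else 2 * r

theorem primrec_cantorDist : Primrec fun c : ℕ × ℕ × ℕ => cantorDist c.1 c.2.1 c.2.2 := by
  refine Primrec.nat_rec' (f := fun c : ℕ × ℕ × ℕ => c.2.2) (g := fun _ => 1)
    (h := fun c p => if initialWord (cantorPoint c.1) (p.1 + 1) =
      initialWord (cantorPoint c.2.1) (p.1 + 1) then 1 else 2 * p.2)
    (by fun_prop) (by fun_prop) ?_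
  refine Primrec.ite (Primrec.eq.comp ?_ ?_) ?_ ?_ <;> fun_prop

attribute [local instance] PiNat.metricSpace

theorem cantor_dist_le_iff {x y : ℕ → Bool} {m : ℕ} :
    dist x y ≤ (1 / 2) ^ m ↔ initialWord x m = initialWord y m := by
  rw [← PiNat.mem_cylinder_iff_dist_le, initialWord_eq_iff]
  rfl

/-- Distinct points have as distance a power of 1/2. The recursion doubles the numerator from the
first disagreement on, so it is exact once `d` exceeds 2^(-k); before that the numerator 1 is good
enough. -/
theorem cantorDist_spec (i j k : ℕ) :
    |dist (cantorPoint i) (cantorPoint j) - (cantorDist i j k : ℝ) / 2 ^ k| ≤ 1 / 2 ^ k := by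
  set d := dist (cantorPoint i) (cantorPoint j) with hd
  have hd0 : 0 ≤ d := dist_nonneg
  have key : (d ≤ (1 / 2) ^ k ∧ cantorDist i j k = 1) ∨
      ((1 / 2) ^ k < d ∧ (cantorDist i j k : ℝ) = 2 ^ k * d) := by
    induction k with
    | zero =>
      refine Or.inl ⟨cantor_dist_le_iff.2 (by simp [initialWord]), rfl⟩
    | succ k ih =>
      have e : cantorDist i j (k + 1) = if initialWord (cantorPoint i) (k + 1) =
        initialWord (cantorPoint j) (k + 1) then 1 else 2 * cantorDist i j k := rfl
      by_cases h : d ≤ (1 / 2) ^ (k + 1)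
      · exact Or.inl ⟨h, by rw [e, if_pos (cantor_dist_le_iff.1 h)]⟩
      · refine Or.inr ⟨not_le.1 h, ?_⟩
        rw [e, if_neg (fun h' => h (cantor_dist_le_iff.2 h'))]
        push_cast
        rcases ih with ⟨h1, h2⟩ | ⟨h1, h2⟩
        -- The first disagreement happens exactly here, since no power of 1/2 lies strictly between
        -- two consecutive ones.
        · have hdk : d = (1 / 2) ^ k := by
            have hne : cantorPoint i ≠ cantorPoint j := by
              intro h'
              apply h
              rw [hd, h', dist_self]
              positivity
            have hf := PiNat.dist_eq_of_ne hne
            rw [← hd] at hf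
            rw [hf] at h h1 ⊢
            have a1 := (pow_le_pow_iff_right_of_lt_one₀ (by norm_num : (0 : ℝ) < 1 / 2)
              (by norm_num)).1 h1
            have a2 : ¬ _ := fun h' => h ((pow_le_pow_iff_right_of_lt_one₀
              (by norm_num : (0 : ℝ) < 1 / 2) (by norm_num)).2 h')
            congr 1
            omega
          rw [h2, hdk, pow_succ, one_div_pow]
          push_cast
          field_simp
        · rw [h2]; ring
  rcases key with ⟨h1, h2⟩ | ⟨h1, h2⟩
  · rw [h2, abs_le]
    rw [one_div_pow] at h1
    push_cast
    constructor <;> linarith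
  · rw [h2, mul_div_cancel_left₀ _ (by positivity), sub_self, abs_zero]
    positivity

/-- The Cantor space as a computable metric space. -/
@[reducible] noncomputable def cantorComputableMetricSpace : ComputableMetricSpace (ℕ → Bool) where
  pt := cantorPoint
  dense_pt := by
    intro x
    rw [Metric.mem_closure_iff]
    intro ε hε
    obtain ⟨m, hm⟩ := exists_pow_lt_of_lt_one hε (by norm_num : (1 / 2 : ℝ) < 1)
    refine ⟨_, ⟨encode (initialWord x m), rfl⟩, lt_of_le_of_lt (cantor_dist_le_iff.2 ?_) hm⟩
    have := initialWord_padWord (initialWord x m)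
    rw [length_initialWord] at this
    rw [cantorPoint_encode, this]
  computable_dist := ⟨_, primrec_cantorDist.to_comp, cantorDist_spec⟩

attribute [local instance] cantorComputableMetricSpace

/-- Distances are zero or powers of 1/2, so being closer than the radius means agreeing on `m`
letters for some 2^(-m) below the radius; clearing denominators leaves an inequality of natural
numbers. -/
theorem mem_cantor_basicBall {c : ℕ × ℕ × ℕ} {x : ℕ → Bool} :
    x ∈ basicBall (ℕ → Bool) c ↔ ∃ m, c.2.2 + 1 < c.2.1 * 2 ^ m ∧
      initialWord x m = initialWord (cantorPoint c.1) m := by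
  have hb : (0 : ℝ) < (c.2.2 : ℝ) + 1 := by positivity
  have hlt : ∀ m : ℕ, (1 / 2 : ℝ) ^ m < (c.2.1 : ℝ) / ((c.2.2 : ℝ) + 1) ↔
      c.2.2 + 1 < c.2.1 * 2 ^ m := by
    intro m
    rw [one_div_pow, div_lt_div_iff₀ (by positivity) hb, one_mul]
    exact_mod_cast Iff.rfl
  simp only [← hlt, ← cantor_dist_le_iff]
  change dist x (cantorPoint c.1) < _ ↔ _
  constructor
  · intro h
    by_cases hx : x = cantorPoint c.1
    · subst hx
      rw [dist_self] at h
      obtain ⟨m, hm⟩ := exists_pow_lt_of_lt_one h (by norm_num : (1 / 2 : ℝ) < 1)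
      exact ⟨m, hm, by rw [dist_self]; positivity⟩
    · have := PiNat.dist_eq_of_ne hx
      exact ⟨_, this ▸ h, this.le⟩
  · rintro ⟨m, h1, h2⟩
    exact h2.trans_lt h1

end EffDyn

namespace EffDyn

open Encodable Topology

/-! ### Zero-dimensional effective dynamical systems are effective dynamical systems -/

theorem _root_.REPred.mem_partrec {α β : Type*} [Primcodable α] [Primcodable β] {φ : α →. β}
    (hφ : Partrec φ) : REPred fun c : α × β => c.2 ∈ φ c.1 := by
  obtain ⟨c, hc⟩ := Nat.Partrec.Code.exists_code.1 hφ
  have h : REPred fun a : (α × β) × ℕ =>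
      Nat.Partrec.Code.evaln a.2 c (encode a.1.1) = some (encode a.1.2) :=
    .eq (Nat.Partrec.Code.primrec_evaln.comp (f := fun x => Nat.Partrec.Code.evaln x.1.1 x.1.2 x.2)
      (g := fun x : (α × β) × ℕ => ((x.2, c), encode x.1.1))
      (by fun_prop)) (by fun_prop)
  refine h.exists'.of_eq fun a => ?_
  simp only [← Option.mem_def]
  rw [← Nat.Partrec.Code.evaln_complete, hc]
  simp

theorem isOpen_cylinder (w : List Bool) : IsOpen (cylinder w) :=
  isOpen_setOf_initialWord (fun v => v = w) w.length

theorem initialWord_mem_iff_cylinder {L : List Bool → Prop} {x : ℕ → Bool} :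
    (∃ m, L (initialWord x m)) ↔ x ∈ ⋃ w ∈ {w | L w}, cylinder w := by
  simp only [Set.mem_iUnion, Set.mem_ofPred_eq, exists_prop]
  constructor
  · rintro ⟨m, hm⟩
    exact ⟨_, hm, by simp [cylinder, length_initialWord]⟩
  · rintro ⟨w, hw, hx⟩
    exact ⟨w.length, by rwa [show initialWord x w.length = w from hx]⟩

theorem EffectivelyClosed.isCompact {Y : Set (ℕ → Bool)} (hY : EffectivelyClosed Y) :
    IsCompact Y := by
  obtain ⟨L, -, rfl⟩ := hY
  exact (isOpen_iUnion fun w => isOpen_iUnion fun _ => isOpen_cylinder w).isClosed_compl.isCompact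

section

attribute [local instance] cantorComputableMetricSpace

/-- A list of balls covers the set iff every sequence of the whole Cantor space has a prefix that is
forbidden or that witnesses membership in one of the balls. -/
theorem EffectivelyClosed.recursivelyCompact {Y : Set (ℕ → Bool)} (hY : EffectivelyClosed Y) :
    RecursivelyCompact (M := ℕ → Bool) Y := by
  refine ⟨hY.isCompact, ?_⟩
  obtain ⟨L, hL, rfl⟩ := hY
  have hS : REPred fun a : List (ℕ × ℕ × ℕ) × List Bool => L a.2 ∨ ∃ c ∈ a.1,
      c.2.2 + 1 < c.2.1 * 2 ^ a.2.length ∧ a.2 = initialWord (cantorPoint c.1) a.2.length := by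
    refine (hL.comp' (by fun_prop)).or (REPred.exists_mem (p := fun
      (a : List (ℕ × ℕ × ℕ) × List Bool) (c : ℕ × ℕ × ℕ) => c.2.2 + 1 < c.2.1 * 2 ^ a.2.length ∧
        a.2 = initialWord (cantorPoint c.1) a.2.length) ?_ (by fun_prop))
    exact (REPred.lt (by fun_prop) (by fun_prop)).and (REPred.eq (by fun_prop) (by fun_prop))
  refine (hS.forall_cantor (S := fun l v => L v ∨ ∃ c ∈ l, c.2.2 + 1 < c.2.1 * 2 ^ v.length ∧
      v = initialWord (cantorPoint c.1) v.length)).of_eq fun l => ?_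
  simp only [length_initialWord, exists_or, initialWord_mem_iff_cylinder]
  refine forall_congr' fun x => ?_
  rw [Set.mem_compl_iff, ← or_iff_not_imp_left]
  refine or_congr_right ?_
  simp only [Set.mem_iUnion, mem_cantor_basicBall, exists_prop]
  constructor
  · rintro ⟨m, c, hc, h⟩
    exact ⟨c, hc, m, h⟩
  · rintro ⟨c, hc, m, h⟩
    exact ⟨m, c, hc, h⟩

/-- The radius is twice 2^(-k), so the open ball is exactly a cylinder of length `k`. -/
theorem mem_cantor_basicBall_two {i b k : ℕ} (hk : b + 1 = 2 ^ k) {x : ℕ → Bool} :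
    x ∈ basicBall (ℕ → Bool) (i, 2, b) ↔ initialWord x k = initialWord (cantorPoint i) k := by
  rw [mem_cantor_basicBall]
  simp only [hk]
  constructor
  · rintro ⟨m, h1, h2⟩
    rw [← pow_succ', Nat.pow_lt_pow_iff_right (by norm_num)] at h1
    rw [initialWord_eq_iff] at h2 ⊢
    exact fun j hj => h2 j (by omega)
  · intro h
    refine ⟨k, ?_, h⟩
    have : 0 < 2 ^ k := by positivity
    omega

theorem ComputableCantorMap.computableMetricMap {Y : Set (ℕ → Bool)} {f : Y → (ℕ → Bool)}
    (hf : ComputableCantorMap f) : ComputableMetricMap (M := ℕ → Bool) f := by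
  obtain ⟨φ, hφ, h⟩ := hf
  -- The witness `(k, v, m)`: the ball is a cylinder of length `k + 1`, `φ` maps its word to `v`,
  -- and the first `m` letters of `v` force the value into the target ball.
  let R : (((ℕ × ℕ × ℕ) × (ℕ × ℕ × ℕ)) × (ℕ × List Bool × ℕ)) → Prop := fun a =>
    (a.1.2.2.1 = 2 ∧ a.1.2.2.2 + 1 = 2 ^ (a.2.1 + 1)) ∧
    (a.2.2.1 ∈ φ (initialWord (cantorPoint a.1.2.1) (a.2.1 + 1)) ∧
      a.2.2.2 ≤ a.2.2.1.length) ∧ a.1.1.2.2 + 1 < a.1.1.2.1 * 2 ^ a.2.2.2 ∧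
      a.2.2.1.take a.2.2.2 = initialWord (cantorPoint a.1.1.1) a.2.2.2
  have hR : REPred R := by
    refine ((REPred.eq ?_ ?_).and (REPred.eq ?_ ?_)).and ((((REPred.mem_partrec hφ).comp'
      (f := fun a : ((ℕ × ℕ × ℕ) × (ℕ × ℕ × ℕ)) × (ℕ × List Bool × ℕ) =>
        (initialWord (cantorPoint a.1.2.1) (a.2.1 + 1), a.2.2.1)) ?_).and (REPred.le ?_ ?_)).and
      ((REPred.lt ?_ ?_).and (REPred.eq (Primrec.list_take.comp ?_ ?_) ?_))) <;> fun_prop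
  refine ⟨_, hR.exists', fun c x => ?_⟩
  obtain ⟨v, hv, -, hx⟩ := h x
  rw [mem_cantor_basicBall]
  constructor
  · rintro ⟨m, h1, h2⟩
    -- Otherwise no output word reaches position `m`, and flipping that bit of `f x` gives a second
    -- point of the intersection.
    obtain ⟨k, hk⟩ : ∃ k, m ≤ (v k).length := by
      by_contra! hlt
      have hfx : f x ∈ ⋂ m, cylinder (v m) := by rw [hx]; rfl
      have : (fun j => if j = m then !(f x m) else f x j) ∈ ⋂ m, cylinder (v m) := by
        rw [Set.mem_iInter] at hfx ⊢
        intro k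
        rw [cylinder, Set.mem_ofPred_eq]
        refine Eq.trans (initialWord_eq_iff.2 fun i hi => ?_) (hfx k)
        rw [if_neg (by have := hlt k; omega)]
      rw [hx] at this
      have := congr_fun (Set.mem_singleton_iff.1 this) m
      simp at this
    have e : initialWord (cantorPoint (encode (initialWord (x : ℕ → Bool) (k + 1)))) (k + 1) =
        initialWord (x : ℕ → Bool) (k + 1) := by
      have := initialWord_padWord (initialWord (x : ℕ → Bool) (k + 1))
      rwa [length_initialWord, ← cantorPoint_encode] at this
    have hb : 2 ^ (k + 1) - 1 + 1 = 2 ^ (k + 1) := Nat.sub_add_cancel Nat.one_le_two_pow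
    refine ⟨(encode (initialWord (x : ℕ → Bool) (k + 1)), 2, 2 ^ (k + 1) - 1),
      ⟨(k, v k, m), ⟨rfl, hb⟩, ⟨?_, hk⟩, h1, ?_⟩, ?_⟩
    · simp only [e]
      exact hv k
    · have hfx : f x ∈ cylinder (v k) := by
        have : f x ∈ ⋂ m, cylinder (v m) := by rw [hx]; rfl
        exact Set.mem_iInter.1 this k
      simp only
      rw [← h2, ← show initialWord (f x) _ = _ from hfx, take_initialWord, min_eq_left hk]
    · rw [mem_cantor_basicBall_two hb, e]
  · rintro ⟨⟨i, a, b⟩, ⟨⟨k, u, m⟩, ⟨ha, hb⟩, ⟨hu, hm⟩, h1, h2⟩, hxd⟩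
    simp only at ha hb hu hm h1 h2
    subst ha
    rw [mem_cantor_basicBall_two hb] at hxd
    refine ⟨m, h1, ?_⟩
    -- The center of the ball need not lie in `Y`; `φ` sees only a prefix, which it shares with `x`.
    rw [← hxd] at hu
    have hvu : u = v k := Part.mem_unique hu (hv k)
    have hfx : f x ∈ cylinder (v k) := by
      have : f x ∈ ⋂ m, cylinder (v m) := by rw [hx]; rfl
      exact Set.mem_iInter.1 this k
    rw [← hvu] at hfx
    rw [← h2, ← show initialWord (f x) _ = _ from hfx, take_initialWord, min_eq_left hm]

end

theorem IsZeroDimEDS.isEDS {G X : Type*} [Group G] [TopologicalSpace X] [MulAction G X]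
    (h : IsZeroDimEDS G X) : IsEDS G X := by
  obtain ⟨Y, act, hY, hf, hc⟩ := h
  exact ⟨ℕ → Bool, cantorComputableMetricSpace, Y, act, hY.recursivelyCompact,
    fun g => (hf g).computableMetricMap, hc⟩

end EffDyn

namespace EffDyn

open Encodable Topology

/-! ### Words -/

section Words

variable {G : Type*} [Group G] {n : ℕ} (s : Fin n → G)

@[simp] theorem wordValue_nil : wordValue s [] = 1 := rfl

@[simp] theorem wordValue_cons (c : Fin n × Bool) (w : GenWord n) :
    wordValue s (c :: w) = (if c.2 then s c.1 else (s c.1)⁻¹) * wordValue s w := by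
  simp [wordValue]

@[simp] theorem wordValue_append (u v : GenWord n) :
    wordValue s (u ++ v) = wordValue s u * wordValue s v := by
  simp [wordValue]

/-- The formal inverse of a word. -/
def invWord (w : GenWord n) : GenWord n := (w.map fun c => (c.1, !c.2)).reverse

@[simp] theorem wordValue_invWord (w : GenWord n) :
    wordValue s (invWord w) = (wordValue s w)⁻¹ := by
  induction w with
  | nil => simp [invWord]
  | cons c w ih =>
    have : invWord (c :: w) = invWord w ++ [(c.1, !c.2)] := by simp [invWord]
    rw [this, wordValue_append, ih]
    obtain ⟨i, b⟩ := c
    cases b <;> simp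

@[fun_prop] theorem primrec_invWord {α : Type*} [Primcodable α] {f : α → GenWord n}
    (hf : Primrec f) : Primrec fun a => invWord (f a) := by
  have : Primrec (invWord : GenWord n → GenWord n) :=
    Primrec.list_reverse.comp (Primrec.list_map Primrec.id
      ((Primrec.fst.comp Primrec.snd).pair (Primrec.not.comp (Primrec.snd.comp Primrec.snd))))
  exact this.comp hf

variable {s}

theorem wordValue_surjective (hs : Subgroup.closure (Set.range s) = ⊤) :
    Function.Surjective (wordValue s) := by
  intro g
  have hg : g ∈ Subgroup.closure (Set.range s) := hs ▸ Subgroup.mem_top g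
  induction hg using Subgroup.closure_induction with
  | mem x hx =>
    obtain ⟨i, rfl⟩ := hx
    exact ⟨[(i, true)], by simp⟩
  | one => exact ⟨[], rfl⟩
  | mul x y _ _ hx hy =>
    obtain ⟨u, rfl⟩ := hx
    obtain ⟨v, rfl⟩ := hy
    exact ⟨u ++ v, by simp⟩
  | inv x _ hx =>
    obtain ⟨u, rfl⟩ := hx
    exact ⟨invWord u, by simp⟩

theorem DecidableWordProblem.rePred_eq (h : DecidableWordProblem s) :
    REPred fun c : GenWord n × GenWord n => wordValue s c.1 = wordValue s c.2 := by
  refine (h.to_re.comp' (f := fun c : GenWord n × GenWord n => invWord c.1 ++ c.2)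
    (by fun_prop)).of_eq fun c => ?_
  rw [wordValue_append, wordValue_invWord, inv_mul_eq_one]

end Words

/-! ### Systems of binary configurations -/

/-- A finite list of prescribed bits; the entry `((w, j), b)` prescribes the `j`-th bit at the
group element represented by `w`. -/
abbrev BinPattern (n : ℕ) : Type := List ((GenWord n × ℕ) × Bool)

section BinSystem

variable {G : Type*} [Group G] {n : ℕ} (s : Fin n → G) (P : BinPattern n → Prop)

/-- The configurations in `({0,1}^ℕ)^G` in which no translate of a pattern in `P` occurs. -/
def binSystem : Set (G → ℕ → Bool) :=
  {x | ∀ g, ∀ p, P p → ∃ c ∈ p, x (g * wordValue s c.1.1) c.1.2 ≠ c.2}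

instance : MulAction G (binSystem s P) where
  smul h x := ⟨fun g => x.1 (h⁻¹ * g), fun g p hp => by
    simpa only [mul_assoc] using x.2 (h⁻¹ * g) p hp⟩
  one_smul x := by
    apply Subtype.ext
    funext g
    change x.1 (1⁻¹ * g) = x.1 g
    simp
  mul_smul a b x := by
    apply Subtype.ext
    funext g
    change x.1 ((a * b)⁻¹ * g) = x.1 (b⁻¹ * (a⁻¹ * g))
    simp [mul_assoc]

theorem binSystem_smul_apply (h : G) (x : binSystem s P) (g : G) :
    (h • x).1 g = x.1 (h⁻¹ * g) := rfl

/-- The pair of a word and an index with a given code. -/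
def position (n : ℕ) (i : ℕ) : GenWord n × ℕ := (decode i).getD ([], 0)

theorem position_encode (c : GenWord n × ℕ) : position n (encode c) = c := by
  simp [position]

@[fun_prop] theorem primrec_position {α : Type*} [Primcodable α] {f : α → ℕ}
    (hf : Primrec f) : Primrec fun a => position n (f a) :=
  Primrec.option_getD.comp (Primrec.decode.comp hf) (Primrec.const _)

/-- The bit sequence of a configuration along all words and indices. -/
def readConfig (x : G → ℕ → Bool) : ℕ → Bool :=
  fun i => x (wordValue s (position n i).1) (position n i).2

theorem readConfig_encode (x : G → ℕ → Bool) (w : GenWord n) (j : ℕ) :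
    readConfig s x (encode (w, j)) = x (wordValue s w) j := by
  simp only [readConfig, position_encode]

/-- The bit sequences of the configurations in `binSystem s P`. -/
def binSet : Set (ℕ → Bool) := readConfig s '' binSystem s P

/-- The word `v` is inconsistent, or contains a pattern in `P`. -/
def Refuted (v : List Bool) : Prop :=
  (∃ a b : ℕ, (v[a]? = some true ∧ v[b]? = some false) ∧ (position n a).2 = (position n b).2 ∧
    wordValue s (position n a).1 = wordValue s (position n b).1) ∨
  ∃ (p : BinPattern n) (u : GenWord n), P p ∧
    ∀ c ∈ p, v[encode (u ++ c.1.1, c.1.2)]? = some c.2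

variable {s P}

/-- A sequence that takes equal values at words for the same group element defines a configuration,
read off at one chosen word per element. Inconsistency and occurrence of a forbidden pattern both
show on a finite prefix. -/
theorem mem_binSet_iff (hs : Subgroup.closure (Set.range s) = ⊤) {y : ℕ → Bool} :
    y ∈ binSet s P ↔ ¬ ∃ m, Refuted s P (initialWord y m) := by
  constructor
  · rintro ⟨x, hx, rfl⟩ ⟨m, ⟨a, b, ⟨ha, hb⟩, hj, hw⟩ | ⟨p, u, hp, h⟩⟩
    · rw [getElem?_initialWord_eq_some] at ha hb
      have : readConfig s x a = readConfig s x b := by simp only [readConfig, hj, hw]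
      rw [ha.2, hb.2] at this
      exact absurd this (by decide)
    · obtain ⟨c, hc, hne⟩ := hx (wordValue s u) p hp
      have := (getElem?_initialWord_eq_some.1 (h c hc)).2
      rw [readConfig_encode, wordValue_append] at this
      exact hne this
  · intro h
    have hcons : ∀ a b, (position n a).2 = (position n b).2 →
        wordValue s (position n a).1 = wordValue s (position n b).1 → y a = y b := by
      have key : ∀ a b, (position n a).2 = (position n b).2 →
          wordValue s (position n a).1 = wordValue s (position n b).1 →
          y a = true → y b = true := by
        intro a b hj hw ha
        by_contra hb
        refine h ⟨max a b + 1, Or.inl ⟨a, b, ⟨?_, ?_⟩, hj, hw⟩⟩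
        · exact getElem?_initialWord_eq_some.2 ⟨by omega, ha⟩
        · exact getElem?_initialWord_eq_some.2 ⟨by omega, by simpa using hb⟩
      intro a b hj hw
      rw [Bool.eq_iff_iff]
      exact ⟨key a b hj hw, key b a hj.symm hw.symm⟩
    obtain ⟨r, hr⟩ := (wordValue_surjective hs).hasRightInverse
    refine ⟨fun g j => y (encode (r g, j)), fun g p hp => ?_, ?_⟩
    · by_contra! hc
      -- A prefix long enough to contain every position of the translated pattern.
      refine h ⟨(p.map fun c => encode (r g ++ c.1.1, c.1.2)).foldr max 0 + 1,
        Or.inr ⟨p, r g, hp, fun c hc' => getElem?_initialWord_eq_some.2 ⟨?_, ?_⟩⟩⟩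
      · have : ∀ (l : List ℕ), ∀ i ∈ l, i < l.foldr max 0 + 1 := by
          intro l
          induction l with
          | nil => simp
          | cons b t ih =>
            intro i hi
            rcases List.mem_cons.1 hi with rfl | hi
            · simp only [List.foldr_cons]; omega
            · have := ih i hi
              simp only [List.foldr_cons]; omega
        exact this _ _ (List.mem_map.2 ⟨c, hc', rfl⟩)
      · rw [← hc c hc']
        exact hcons _ _ (by simp only [position_encode])
          (by simp only [position_encode, wordValue_append, hr _])
    · funext i
      exact hcons _ _ (by simp only [position_encode])
        (by simp only [position_encode, hr _])

/-- The word problem enters here, to recognize two words for the same element. The parameter `a`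
makes the result uniform in the set of patterns. -/
theorem rePred_refuted (hWP : DecidableWordProblem s) {α : Type*} [Primcodable α]
    {P : α → BinPattern n → Prop} (hP : REPred fun c : α × BinPattern n => P c.1 c.2) :
    REPred fun c : α × List Bool => Refuted s (P c.1) c.2 := by
  have h1 : REPred fun c : (α × List Bool) × (ℕ × ℕ) =>
      (c.1.2[c.2.1]? = some true ∧ c.1.2[c.2.2]? = some false) ∧
      (position n c.2.1).2 = (position n c.2.2).2 ∧
      wordValue s (position n c.2.1).1 = wordValue s (position n c.2.2).1 := by
    refine ((REPred.eq ?_ ?_).and (REPred.eq ?_ ?_)).and ((REPred.eq ?_ ?_).and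
      (hWP.rePred_eq.comp' (f := fun c : (α × List Bool) × (ℕ × ℕ) =>
        ((position n c.2.1).1, (position n c.2.2).1)) ?_)) <;> fun_prop
  have h2 : REPred fun c : (α × List Bool) × (BinPattern n × GenWord n) => P c.1.1 c.2.1 ∧
      ∀ e ∈ c.2.1, c.1.2[encode (c.2.2 ++ e.1.1, e.1.2)]? = some e.2 := by
    refine (hP.comp' (f := fun c : (α × List Bool) × (BinPattern n × GenWord n) =>
      (c.1.1, c.2.1)) (by fun_prop)).and (REPred.forall_mem (p := fun
        (c : (α × List Bool) × (BinPattern n × GenWord n)) (e : (GenWord n × ℕ) × Bool) =>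
        c.1.2[encode (c.2.2 ++ e.1.1, e.1.2)]? = some e.2) ?_ (by fun_prop))
    exact .eq (by fun_prop) (by fun_prop)
  exact (h1.exists'.or h2.exists').of_eq fun c => by simp only [Refuted, Prod.exists]

theorem effectivelyClosed_binSet (hs : Subgroup.closure (Set.range s) = ⊤)
    (hWP : DecidableWordProblem s) (hP : REPred P) : EffectivelyClosed (binSet s P) := by
  refine ⟨Refuted s P, ?_, ?_⟩
  · exact (rePred_refuted hWP (α := Unit) (P := fun _ => P) (hP.comp' (by fun_prop))).comp'
      (f := fun v => ((), v)) (by fun_prop)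
  · ext y
    rw [mem_binSet_iff hs, initialWord_mem_iff_cylinder, Set.mem_compl_iff]

/-- Emptiness means that every bit sequence is refuted by a finite prefix, which compactness makes
enumerable. -/
theorem rePred_binSystem_eq_empty (hs : Subgroup.closure (Set.range s) = ⊤)
    (hWP : DecidableWordProblem s) {α : Type*} [Primcodable α]
    {P : α → BinPattern n → Prop} (hP : REPred fun c : α × BinPattern n => P c.1 c.2) :
    REPred fun a => ¬ (binSystem s (P a)).Nonempty := by
  refine (REPred.forall_cantor (S := fun a => Refuted s (P a)) (rePred_refuted hWP hP)).of_eq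
    fun a => ?_
  rw [Set.not_nonempty_iff_eq_empty, ← Set.image_eq_empty (f := readConfig s),
    Set.eq_empty_iff_forall_notMem]
  refine forall_congr' fun y => ?_
  rw [← not_iff_not, not_not]
  exact (mem_binSet_iff hs).symm

variable (P)

/-- A configuration is determined by its bit sequence. -/
noncomputable def binHomeomorph (hs : Subgroup.closure (Set.range s) = ⊤) :
    binSet s P ≃ₜ binSystem s P where
  toFun y := ⟨fun g j => y.1 (encode (Function.surjInv (wordValue_surjective hs) g, j)), by
    obtain ⟨_, x, hx, rfl⟩ := y
    convert hx using 3 with g j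
    simp only [readConfig_encode, Function.surjInv_eq]⟩
  invFun x := ⟨readConfig s x.1, x.1, x.2, rfl⟩
  left_inv y := by
    obtain ⟨_, x, hx, rfl⟩ := y
    apply Subtype.ext
    funext i
    simp only [readConfig_encode, Function.surjInv_eq]
  right_inv x := by
    apply Subtype.ext
    funext g j
    exact (readConfig_encode s x.1 _ j).trans
      (by rw [Function.surjInv_eq (wordValue_surjective hs)])
  continuous_toFun := by
    refine Continuous.subtype_mk (continuous_pi fun g => continuous_pi fun j => ?_) _
    exact (continuous_apply _).comp continuous_subtype_val
  continuous_invFun := by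
    refine Continuous.subtype_mk (continuous_pi fun i => ?_) _
    exact (continuous_apply _).comp ((continuous_apply _).comp continuous_subtype_val)

end BinSystem

/-- A prefix of length `m` determines the first `ℓ m` output bits, where `ℓ m` counts the initial
outputs that read only positions below `m`. As `ℓ` is monotone and unbounded, the output cylinders
shrink to the value. -/
theorem computableCantorMap_of_reindex {Y : Set (ℕ → Bool)} {f : Y → (ℕ → Bool)} {σ : ℕ → ℕ}
    (hσ : Primrec σ) (hf : ∀ y i, f y i = y.1 (σ i)) : ComputableCantorMap f := by
  classical
  let ℓ : ℕ → ℕ := fun m => Nat.findGreatest (fun l => ∀ i < l, σ i < m) m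
  have hp : PrimrecRel fun (m l : ℕ) => ∀ i < l, σ i < m := by
    have h : PrimrecRel fun i m => σ i < m := Primrec.nat_lt.comp (hσ.comp Primrec.fst) Primrec.snd
    exact (h.forall_mem_list.comp (f := fun c : ℕ × ℕ => List.range c.2) (g := fun c => c.1)
      (Primrec.list_range.comp (by fun_prop)) (by fun_prop)).of_eq fun c => by simp
  have hℓ : Primrec ℓ := Primrec.nat_findGreatest Primrec.id hp
  have hℓσ : ∀ m, ∀ i < ℓ m, σ i < m := fun m =>
    Nat.findGreatest_spec (P := fun l => ∀ i < l, σ i < m) (Nat.zero_le m) (by simp)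
  have hmono : Monotone ℓ := fun a b hab =>
    Nat.findGreatest_mono (fun l hl i hi => (hl i hi).trans_le hab) hab
  have hunb : ∀ N, ∃ m, N ≤ ℓ (m + 1) := by
    intro N
    refine ⟨max N ((Finset.range N).sup σ), Nat.le_findGreatest (by omega) fun i hi => ?_⟩
    have := Finset.le_sup (f := σ) (Finset.mem_range.2 hi)
    omega
  let φ : List Bool → List Bool := fun v =>
    (List.range (ℓ v.length)).map fun i => v.getD (σ i) false
  have hφ : Primrec φ := by
    refine Primrec.list_map (Primrec.list_range.comp (by fun_prop)) ?_
    exact (Primrec.list_getD false).comp Primrec.fst (hσ.comp Primrec.snd)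
  refine ⟨fun v => Part.some (φ v), hφ.to_comp.partrec, fun y =>
    ⟨fun m => initialWord (f y) (ℓ (m + 1)), fun m => ?_, fun a b hab => ?_, ?_⟩⟩
  · rw [Part.mem_some_iff]
    simp only [φ, length_initialWord]
    refine List.map_congr_left fun i hi => ?_
    have := hℓσ _ i (List.mem_range.1 hi)
    rw [hf, List.getD_eq_getElem?_getD, getElem?_initialWord_eq_some.2 ⟨this, rfl⟩]
    rfl
  · intro x hx
    simp only [cylinder, Set.mem_ofPred_eq, length_initialWord, initialWord_eq_iff] at hx ⊢
    exact fun i hi => hx i (hi.trans_le (hmono (by omega)))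
  · ext x
    simp only [cylinder, Set.mem_iInter, Set.mem_ofPred_eq, length_initialWord,
      initialWord_eq_iff, Set.mem_singleton_iff]
    constructor
    · intro h
      funext i
      obtain ⟨m, hm⟩ := hunb (i + 1)
      exact h m i hm
    · rintro rfl _ _ _
      rfl

/-! ### The shift action as a zero-dimensional system. -/

section

variable {G : Type*} [Group G] {n : ℕ} {s : Fin n → G} (P : BinPattern n → Prop)

/-- The shift action on bit sequences. -/
@[reducible] noncomputable def binSetAction (hs : Subgroup.closure (Set.range s) = ⊤) :
    MulAction G (binSet s P) := (binHomeomorph P hs).toEquiv.mulAction G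

theorem binHomeomorph_smul (hs : Subgroup.closure (Set.range s) = ⊤) (g : G) (y : binSet s P) :
    binHomeomorph P hs (letI := binSetAction P hs; g • y) = g • binHomeomorph P hs y :=
  (binHomeomorph P hs).apply_symm_apply _

/-- If `u` represents `g⁻¹`, acting by `g` moves the bit at `(u ++ w, j)` to `(w, j)`, which is a
primitive recursive reindexing. -/
theorem isZeroDimEDS_binSet (hs : Subgroup.closure (Set.range s) = ⊤)
    (hWP : DecidableWordProblem s) (hP : REPred P) :
    @IsZeroDimEDS G (binSet s P) _ _ (binSetAction P hs) := by
  let _ := binSetAction P hs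
  refine ⟨binSet s P, binSetAction P hs, effectivelyClosed_binSet hs hWP hP, fun g => ?_,
    Homeomorph.refl _, fun _ _ => rfl⟩
  obtain ⟨u, hu⟩ := wordValue_surjective hs g⁻¹
  refine computableCantorMap_of_reindex
    (σ := fun i => encode (u ++ (position n i).1, (position n i).2)) (by fun_prop) fun y i => ?_
  obtain ⟨x, rfl⟩ := (binHomeomorph P hs).symm.surjective y
  have h1 : g • (binHomeomorph P hs).symm x = (binHomeomorph P hs).symm (g • x) := by
    rw [Homeomorph.eq_symm_apply, binHomeomorph_smul, Homeomorph.apply_symm_apply]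
  rw [h1]
  change readConfig s (g • x).1 i = readConfig s x.1 _
  rw [readConfig_encode, wordValue_append, hu]
  rfl

end

end EffDyn

namespace EffDyn

open Encodable

/-! ### The domino problem for binary configurations -/

section Domino

variable {G : Type*} [Group G] {n : ℕ} (s : Fin n → G)

/-- There is an algorithm which decides whether the binary system given by a finite list of
forbidden patterns is nonempty. -/
def DecidableBinaryDomino : Prop :=
  ComputablePred fun P : List (BinPattern n) => (binSystem s (· ∈ P)).Nonempty

theorem mem_binSystem_iff {P : BinPattern n → Prop} {x : G → ℕ → Bool} :
    x ∈ binSystem s P ↔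
      ∀ g, ∀ p, P p → ¬ ∀ c ∈ p, x (g * wordValue s c.1.1) c.1.2 = c.2 := by
  refine forall_congr' fun g => forall_congr' fun p => forall_congr' fun _ => ?_
  push Not
  rfl

theorem mem_sft_iff {k : ℕ} {T : List (PatternCode n)} {x : G → Fin k} :
    x ∈ sft s k T ↔ ∀ g, ∀ p ∈ T, ¬ ∀ c ∈ p, (x (g * wordValue s c.1) : ℕ) = c.2 := by
  simp only [sft, Set.mem_compl_iff, Set.mem_iUnion, not_exists, Set.mem_image]
  refine forall_congr' fun g => forall_congr' fun p => forall_congr' fun _ => ?_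
  constructor
  · intro h hc
    refine h (leftShift g⁻¹ x) ⟨fun c hc' => ?_, ?_⟩
    · simpa [leftShift] using hc c hc'
    · funext a
      simp [leftShift]
  · rintro h z ⟨hz, rfl⟩
    refine h fun c hc => ?_
    simpa [leftShift] using hz c hc

/-- One-hot binary patterns that describe a subshift of finite type. -/
def oneHot (t : ℕ × List (PatternCode n)) : List (BinPattern n) :=
  (List.range t.1).map (fun j => (([], j), false)) ::
    t.2.map fun p => p.map fun c => (c, true)

theorem primrec_oneHot : Primrec (oneHot : ℕ × List (PatternCode n) → List (BinPattern n)) := by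
  refine Primrec.list_cons.comp (Primrec.list_map (Primrec.list_range.comp (by fun_prop)) ?_)
    (Primrec.list_map (by fun_prop) (Primrec.list_map (by fun_prop) ?_)) <;>
    (unfold Primrec₂; fun_prop)

/-- The head pattern only ensures that some letter is marked at each element. Several may be marked;
any choice among them works, because the other patterns prescribe marked letters only. -/
theorem nonempty_binSystem_oneHot (t : ℕ × List (PatternCode n)) :
    (binSystem s (· ∈ oneHot t)).Nonempty ↔ (sft s t.1 t.2).Nonempty := by
  constructor
  · rintro ⟨y, hy⟩
    rw [mem_binSystem_iff] at hy
    have h1 : ∀ g, ∃ a : Fin t.1, y g a = true := by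
      intro g
      have := hy g _ List.mem_cons_self
      simp only [List.mem_map, List.mem_range] at this
      push Not at this
      obtain ⟨_, ⟨j, hj, rfl⟩, h⟩ := this
      exact ⟨⟨j, hj⟩, by simpa using h⟩
    choose a ha using h1
    refine ⟨a, (mem_sft_iff s).2 fun g p hp h => hy g (p.map fun c => (c, true)) ?_ ?_⟩
    · exact List.mem_cons_of_mem _ (List.mem_map.2 ⟨p, hp, rfl⟩)
    · intro c hc
      obtain ⟨c, hc', rfl⟩ := List.mem_map.1 hc
      have := ha (g * wordValue s c.1)
      rwa [h c hc'] at this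
  · rintro ⟨x, hx⟩
    rw [mem_sft_iff] at hx
    refine ⟨fun g j => decide ((x g : ℕ) = j), (mem_binSystem_iff s).2 fun g p hp h => ?_⟩
    rcases List.mem_cons.1 hp with rfl | hp
    · have := h (([], (x g : ℕ)), false) (List.mem_map.2 ⟨x g, by simp, rfl⟩)
      simp at this
    · obtain ⟨q, hq, rfl⟩ := List.mem_map.1 hp
      refine hx g q hq fun c hc => ?_
      simpa using h (c, true) (List.mem_map.2 ⟨c, hc, rfl⟩)

/-- The patterns over the alphabet `{0, …, k - 1}` whose letters have the prescribed binary
digits. -/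
def letterLifts (k : ℕ) (p : BinPattern n) : List (PatternCode n) :=
  p.foldr (fun c Q => Q.flatMap fun q =>
    ((List.range k).filter fun a => Nat.testBit a c.1.2 = c.2).map fun a => (c.1.1, a) :: q) [[]]

@[fun_prop] theorem primrec_testBit {α : Type*} [Primcodable α] {f g : α → ℕ} (hf : Primrec f)
    (hg : Primrec g) : Primrec fun a => Nat.testBit (f a) (g a) := by
  have : Primrec fun a => decide (f a / 2 ^ g a % 2 = 1) :=
    PrimrecPred.decide (Primrec.eq.comp (Primrec.nat_mod.comp
      (Primrec.nat_div.comp hf (by fun_prop)) (by fun_prop)) (by fun_prop))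
  exact this.of_eq fun a => (Nat.testBit_eq_decide_div_mod_eq).symm

theorem primrec_letterLifts :
    Primrec fun a : ℕ × BinPattern n => letterLifts a.1 a.2 := by
  refine Primrec.list_foldr (f := fun a : ℕ × BinPattern n => a.2) (g := fun _ => [[]])
    (h := fun a cQ => cQ.2.flatMap fun q => ((List.range a.1).filter fun b =>
      Nat.testBit b cQ.1.1.2 = cQ.1.2).map fun b => (cQ.1.1.1, b) :: q)
    (by fun_prop) (by fun_prop) ?_
  refine Primrec.list_flatMap (by fun_prop) ?_
  refine Primrec.list_map ?_ (by unfold Primrec₂; fun_prop)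
  have hR : PrimrecRel fun (b : ℕ) (e : ((GenWord n × ℕ) × Bool)) =>
      Nat.testBit b e.1.2 = e.2 := Primrec.eq.comp (by fun_prop) (by fun_prop)
  exact hR.listFilter.comp
    (f := fun L (b : (GenWord n × ℕ) × Bool) => L.filter fun a => Nat.testBit a b.1.2 = b.2) (g := fun x : ((ℕ × BinPattern n) × (((GenWord n × ℕ) × Bool) ×
    List (PatternCode n))) × PatternCode n => List.range x.1.1.1) (h := fun x => x.1.2.1)
    (Primrec.list_range.comp (by fun_prop)) (by fun_prop)

/-- The lifts run through all letters below `k` with the right digit, so the values of `f`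
themselves supply the matching lift. Lifts that give two letters to one word match nothing. -/
theorem exists_mem_letterLifts_iff {k : ℕ} {f : GenWord n → ℕ} (hf : ∀ w, f w < k)
    (p : BinPattern n) : (∃ q ∈ letterLifts k p, ∀ e ∈ q, f e.1 = e.2) ↔
      ∀ c ∈ p, Nat.testBit (f c.1.1) c.1.2 = c.2 := by
  induction p with
  | nil => simp [letterLifts]
  | cons c p ih =>
    have e : letterLifts k (c :: p) = (letterLifts k p).flatMap fun q =>
      ((List.range k).filter fun a => Nat.testBit a c.1.2 = c.2).map fun a => (c.1.1, a) :: q := rfl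
    rw [List.forall_mem_cons, ← ih, e]
    simp only [List.mem_flatMap, List.mem_map, List.mem_filter, List.mem_range, decide_eq_true_eq]
    constructor
    · rintro ⟨_, ⟨q, hq, a, ⟨-, ha⟩, rfl⟩, h⟩
      rw [List.forall_mem_cons] at h
      exact ⟨by rw [h.1]; exact ha, q, hq, h.2⟩
    · rintro ⟨h, q, hq, hq'⟩
      exact ⟨_, ⟨q, hq, f c.1.1, ⟨hf _, h⟩, rfl⟩, List.forall_mem_cons.2 ⟨rfl, hq'⟩⟩

/-- A strict bound for the indices in a list of binary patterns. -/
def indexBound (P : List (BinPattern n)) : ℕ := P.flatten.foldr (fun c r => c.1.2 + 1 + r) 0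

theorem lt_indexBound {P : List (BinPattern n)} {p : BinPattern n} (hp : p ∈ P)
    {c : (GenWord n × ℕ) × Bool} (hc : c ∈ p) : c.1.2 < indexBound P := by
  have hc : c ∈ P.flatten := List.mem_flatten.2 ⟨p, hp, hc⟩
  unfold indexBound
  generalize P.flatten = l at hc
  induction l with
  | nil => simp at hc
  | cons e l ih =>
    rw [List.foldr_cons]
    rcases List.mem_cons.1 hc with rfl | hc
    · omega
    · have := ih hc
      omega

theorem primrec_indexBound : Primrec (indexBound : List (BinPattern n) → ℕ) :=
  Primrec.list_foldr Primrec.list_flatten (Primrec.const 0)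
    (h := fun _ (c : ((GenWord n × ℕ) × Bool) × ℕ) => c.1.1.2 + 1 + c.2) (by unfold Primrec₂; fun_prop)

/-- The subshift of finite type that codes a finite list of binary patterns. -/
def blockCode (P : List (BinPattern n)) : ℕ × List (PatternCode n) :=
  (2 ^ indexBound P, P.flatMap (letterLifts (2 ^ indexBound P)))

theorem primrec_blockCode : Primrec (blockCode : List (BinPattern n) → _) := by
  have := primrec_indexBound (n := n)
  refine Primrec.pair (by fun_prop) (Primrec.list_flatMap (by fun_prop) ?_)
  exact primrec_letterLifts.comp (f := fun a : ℕ × BinPattern n => letterLifts a.1 a.2)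
    (g := fun a : List (BinPattern n) × BinPattern n => (2 ^ indexBound a.1, a.2)) (by fun_prop)

/-- The patterns mention only indices below `indexBound P`, so a letter with that many binary digits
carries all constrained bits; the rest are free. -/
theorem nonempty_sft_blockCode (P : List (BinPattern n)) :
    (sft s (blockCode P).1 (blockCode P).2).Nonempty ↔ (binSystem s (· ∈ P)).Nonempty := by
  constructor
  · rintro ⟨x, hx⟩
    rw [mem_sft_iff] at hx
    refine ⟨fun g j => Nat.testBit (x g) j, (mem_binSystem_iff s).2 fun g p hp h => ?_⟩
    obtain ⟨q, hq, hq'⟩ := (exists_mem_letterLifts_iff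
      (f := fun w => (x (g * wordValue s w) : ℕ)) (fun w => (x _).2) p).2 h
    exact hx g q (List.mem_flatMap.2 ⟨p, hp, hq⟩) hq'
  · rintro ⟨y, hy⟩
    rw [mem_binSystem_iff] at hy
    let x : G → Fin (2 ^ indexBound P) := fun g =>
      ⟨Nat.ofBits fun i : Fin (indexBound P) => y g i, Nat.ofBits_lt_two_pow _⟩
    refine ⟨x, (mem_sft_iff s).2 fun g q hq h => ?_⟩
    obtain ⟨p, hp, hq⟩ := List.mem_flatMap.1 hq
    refine hy g p hp fun c hc => ?_
    rw [← (exists_mem_letterLifts_iff (f := fun w => (x (g * wordValue s w) : ℕ))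
      (fun w => (x _).2) p).1 ⟨q, hq, h⟩ c hc]
    exact (Nat.testBit_ofBits_lt (fun i : Fin (indexBound P) => y (g * wordValue s c.1.1) i) _
      (lt_indexBound hp hc)).symm

theorem decidableDominoProblem_iff : DecidableDominoProblem s ↔ DecidableBinaryDomino s :=
  ⟨ComputablePred.computable_of_manyOneReducible
      ⟨blockCode, primrec_blockCode.to_comp, fun P => (nonempty_sft_blockCode s P).symm⟩,
    ComputablePred.computable_of_manyOneReducible
      ⟨oneHot, primrec_oneHot.to_comp, fun t => (nonempty_binSystem_oneHot s t).symm⟩⟩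

end Domino

end EffDyn

namespace EffDyn

open Encodable Topology

/-! ### Covers of recursively compact sets -/

section Balls

variable {M : Type*} [ComputableMetricSpace M]

/-- The radius of the basic ball with a given index. -/
noncomputable def ballRadius (c : ℕ × ℕ × ℕ) : ℝ := (c.2.1 : ℝ) / ((c.2.2 : ℝ) + 1)

theorem mem_basicBall_iff {c : ℕ × ℕ × ℕ} {z : M} :
    z ∈ basicBall M c ↔ dist z (ComputableMetricSpace.pt c.1) < ballRadius c := Iff.rfl

theorem isOpen_basicBall (c : ℕ × ℕ × ℕ) : IsOpen (basicBall M c) := Metric.isOpen_ball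

variable (M) in
/-- The distance of the centers certifies that the two basic balls are apart. -/
def FarBall (d c : ℕ × ℕ × ℕ) : Prop :=
  ballRadius d + ballRadius c <
    dist (ComputableMetricSpace.pt d.1 : M) (ComputableMetricSpace.pt c.1)

variable (M) in
-- A strict inequality between a rational and a computable real is confirmed by an approximation
-- that exceeds the rational by more than its error.
theorem rePred_farBall :
    REPred fun t : (ℕ × ℕ × ℕ) × (ℕ × ℕ × ℕ) => FarBall M t.1 t.2 := by
  obtain ⟨q, hq, h⟩ := ComputableMetricSpace.computable_dist (M := M)
  have h1 : REPred fun t : (((ℕ × ℕ × ℕ) × (ℕ × ℕ × ℕ)) × ℕ) × ℕ =>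
      2 ^ t.1.2 * (t.1.1.1.2.1 * (t.1.1.2.2.2 + 1) + t.1.1.2.2.1 * (t.1.1.1.2.2 + 1)) +
        (t.1.1.1.2.2 + 1) * (t.1.1.2.2.2 + 1) <
      t.2 * ((t.1.1.1.2.2 + 1) * (t.1.1.2.2.2 + 1)) := .lt (by fun_prop) (by fun_prop)
  have h2 := h1.comp (f := fun t : ((ℕ × ℕ × ℕ) × (ℕ × ℕ × ℕ)) × ℕ =>
    (t, q (t.1.1.1, t.1.2.1, t.2))) (Computable.id.pair (hq.comp (Primrec.to_comp (by fun_prop))))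
  refine h2.exists'.of_eq fun ⟨⟨i, a, b⟩, ⟨j, a', b'⟩⟩ => ?_
  simp only [FarBall, ballRadius]
  set D := dist (ComputableMetricSpace.pt i : M) (ComputableMetricSpace.pt j)
  set r : ℝ := (a : ℝ) / ((b : ℝ) + 1) + (a' : ℝ) / ((b' : ℝ) + 1) with hr
  have key : ∀ k : ℕ, 2 ^ k * (a * (b' + 1) + a' * (b + 1)) + (b + 1) * (b' + 1) <
      q (i, j, k) * ((b + 1) * (b' + 1)) ↔ r + 1 / 2 ^ k < (q (i, j, k) : ℝ) / 2 ^ k := by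
    intro k
    have hB : (0 : ℝ) < ((b : ℝ) + 1) * ((b' : ℝ) + 1) := by positivity
    have e : r = ((a : ℝ) * ((b' : ℝ) + 1) + a' * ((b : ℝ) + 1)) /
        (((b : ℝ) + 1) * ((b' : ℝ) + 1)) := by rw [hr]; field_simp
    rw [e, div_add_div _ _ hB.ne' (by positivity), div_lt_div_iff₀ (by positivity) (by positivity),
      ← mul_assoc (q (i, j, k) : ℝ), mul_lt_mul_iff_left₀ (by positivity)]
    rw [← Nat.cast_lt (α := ℝ)]
    push_cast
    constructor <;> intro h <;> linarith
  simp only [key]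
  constructor
  · rintro ⟨k, hk⟩
    have := abs_le.1 (h i j k)
    linarith [this.1]
  · intro hD
    -- Half of the gap: one error 2^(-k) is lost in the approximation and one is part of the test.
    obtain ⟨k, hk⟩ := exists_pow_lt_of_lt_one (show 0 < (D - r) / 2 by linarith)
      (by norm_num : (1 / 2 : ℝ) < 1)
    rw [one_div_pow] at hk
    have := abs_le.1 (h i j k)
    exact ⟨k, by linarith [this.2]⟩

theorem FarBall.lt_dist {d c : ℕ × ℕ × ℕ} (h : FarBall M d c) {z : M} (hz : z ∈ basicBall M d) :
    ballRadius c < dist z (ComputableMetricSpace.pt c.1) := by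
  have h1 := dist_triangle_left (ComputableMetricSpace.pt d.1 : M) (ComputableMetricSpace.pt c.1) z
  rw [mem_basicBall_iff] at hz
  unfold FarBall at h
  linarith

theorem exists_basicBall_small (z : M) {ε : ℝ} (hε : 0 < ε) :
    ∃ i b, z ∈ basicBall M (i, 1, b) ∧ 1 / ((b : ℝ) + 1) < ε := by
  obtain ⟨b, hb⟩ := exists_nat_one_div_lt hε
  obtain ⟨i, hi⟩ := (ComputableMetricSpace.dense_pt (M := M)).exists_dist_lt z
    (show (0 : ℝ) < 1 / ((b : ℝ) + 1) by positivity)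
  exact ⟨i, b, by simpa [mem_basicBall_iff, ballRadius] using hi, hb⟩

/-- Finitely many strict inequalities leave a common gap of 2ε. In a ball of radius below ε around a
point near `z`, the radius and the displacement of the center each use up less than ε. -/
theorem exists_farBall {l : List (ℕ × ℕ × ℕ)} {z : M}
    (h : ∀ c ∈ l, ballRadius c < dist z (ComputableMetricSpace.pt c.1)) :
    ∃ d, z ∈ basicBall M d ∧ ∀ c ∈ l, FarBall M d c := by
  obtain ⟨ε, hε, hl⟩ : ∃ ε > 0, ∀ c ∈ l,
      ballRadius c + 2 * ε ≤ dist z (ComputableMetricSpace.pt c.1) := by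
    induction l with
    | nil => exact ⟨1, one_pos, by simp⟩
    | cons c l ih =>
      obtain ⟨ε, hε, hl⟩ := ih fun c hc => h c (List.mem_cons_of_mem _ hc)
      have hc := h c List.mem_cons_self
      refine ⟨min ε ((dist z (ComputableMetricSpace.pt c.1) - ballRadius c) / 2),
        lt_min hε (by linarith), fun e he => ?_⟩
      rcases List.mem_cons.1 he with rfl | he
      · have := min_le_right ε ((dist z (ComputableMetricSpace.pt e.1) - ballRadius e) / 2)
        linarith
      · have := min_le_left ε ((dist z (ComputableMetricSpace.pt c.1) - ballRadius c) / 2)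
        linarith [hl e he]
  obtain ⟨i, b, hz, hb⟩ := exists_basicBall_small z hε
  refine ⟨_, hz, fun c hc => ?_⟩
  have h1 := dist_triangle z (ComputableMetricSpace.pt i : M) (ComputableMetricSpace.pt c.1)
  rw [mem_basicBall_iff] at hz
  have h2 := hl c hc
  have e : ballRadius (i, 1, b) = 1 / ((b : ℝ) + 1) := by simp [ballRadius]
  rw [e] at hz
  simp only at hz
  rw [FarBall, e]
  linarith

/-- By compactness finitely many of the balls already cover `K`, so one searches for a list that is
enumerated as a cover and all of whose members are enumerated by `Q`. -/
theorem RecursivelyCompact.rePred_cover {K : Set M} (hK : RecursivelyCompact K) {α : Type*}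
    [Primcodable α] {Q : α × (ℕ × ℕ × ℕ) → Prop} (hQ : REPred Q) :
    REPred fun a => ∀ y : K, ∃ d, Q (a, d) ∧ (y : M) ∈ basicBall M d := by
  obtain ⟨hc, hre⟩ := hK
  have h : REPred fun c : α × List (ℕ × ℕ × ℕ) =>
      (K ⊆ ⋃ d ∈ c.2, basicBall M d) ∧ ∀ d ∈ c.2, Q (c.1, d) :=
    (hre.comp' (by fun_prop)).and (REPred.forall_mem
      (p := fun (c : α × List (ℕ × ℕ × ℕ)) d => Q (c.1, d)) (hQ.comp' (by fun_prop))
      (by fun_prop))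
  refine h.exists'.of_eq fun a => ⟨?_, fun H => ?_⟩
  · rintro ⟨l, hl, hQ'⟩ y
    obtain ⟨d, hd, hy⟩ := Set.mem_iUnion₂.1 (hl y.2)
    exact ⟨d, hQ' d hd, hy⟩
  · obtain ⟨t, ht⟩ := hc.elim_finite_subcover (fun d : {d // Q (a, d)} => basicBall M d.1)
      (fun _ => isOpen_basicBall _) fun y hy => by
        obtain ⟨d, hd, hyd⟩ := H ⟨y, hy⟩
        exact Set.mem_iUnion.2 ⟨⟨d, hd⟩, hyd⟩
    refine ⟨t.toList.map Subtype.val, fun y hy => ?_, fun d hd => ?_⟩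
    · obtain ⟨d, hd, hyd⟩ := Set.mem_iUnion₂.1 (ht hy)
      exact Set.mem_iUnion₂.2 ⟨d.1, List.mem_map.2 ⟨d, by simpa using hd, rfl⟩, hyd⟩
    · obtain ⟨d, -, rfl⟩ := List.mem_map.1 hd
      exact d.2

end Balls

/-! ### Compositions of enumerable relations. -/

section Chain

variable {Λ I : Type*}

/-- The composition of the relations `E l` along a list of labels `l`. -/
def RelChain (E : Λ → I → I → Prop) : List Λ → I → I → Prop
  | [], c, d => c = d
  | l :: u, c, d => ∃ e, E l c e ∧ RelChain E u e d

/-- The recursion along the word is replaced by the existence of a finite derivation: a list of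
triples each of which is trivial or justified by a triple of the list. Justifications shorten the
word, so they cannot be circular. -/
theorem rePred_relChain [Primcodable Λ] [Primcodable I] {E : Λ → I → I → Prop}
    (hE : REPred fun t : Λ × I × I => E t.1 t.2.1 t.2.2) :
    REPred fun t : List Λ × I × I => RelChain E t.1 t.2.1 t.2.2 := by
  have h1 : REPred fun x : (List (List Λ × I × I) × (List Λ × I × I)) × (Λ × List Λ × I) =>
      x.1.2.1 = x.2.1 :: x.2.2.1 ∧ E x.2.1 x.1.2.2.1 x.2.2.2 ∧
        (x.2.2.1, x.2.2.2, x.1.2.2.2) ∈ x.1.1 :=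
    (REPred.eq (by fun_prop) (by fun_prop)).and ((hE.comp'
      (f := fun x : (List (List Λ × I × I) × (List Λ × I × I)) × (Λ × List Λ × I) =>
        (x.2.1, x.1.2.2.1, x.2.2.2)) (by fun_prop)).and (REPred.mem (by fun_prop) (by fun_prop)))
  have h2 : REPred fun x : List (List Λ × I × I) × (List Λ × I × I) =>
      (x.2.1 = [] ∧ x.2.2.1 = x.2.2.2) ∨ ∃ y : Λ × List Λ × I,
        x.2.1 = y.1 :: y.2.1 ∧ E y.1 x.2.2.1 y.2.2 ∧ (y.2.1, y.2.2, x.2.2.2) ∈ x.1 :=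
    ((REPred.eq (by fun_prop) (by fun_prop)).and (REPred.eq (by fun_prop) (by fun_prop))).or
      h1.exists'
  have h3 : REPred fun x : (List Λ × I × I) × List (List Λ × I × I) => x.1 ∈ x.2 ∧ ∀ t ∈ x.2,
      (t.1 = [] ∧ t.2.1 = t.2.2) ∨ ∃ y : Λ × List Λ × I,
        t.1 = y.1 :: y.2.1 ∧ E y.1 t.2.1 y.2.2 ∧ (y.2.1, y.2.2, t.2.2) ∈ x.2 :=
    (REPred.mem (by fun_prop) (by fun_prop)).and (REPred.forall_mem
      (p := fun (x : (List Λ × I × I) × List (List Λ × I × I)) (t : List Λ × I × I) =>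
        (t.1 = [] ∧ t.2.1 = t.2.2) ∨ ∃ y : Λ × List Λ × I,
        t.1 = y.1 :: y.2.1 ∧ E y.1 t.2.1 y.2.2 ∧ (y.2.1, y.2.2, t.2.2) ∈ x.2)
      (h2.comp' (f := fun x : ((List Λ × I × I) × List (List Λ × I × I)) × (List Λ × I × I) =>
        (x.1.2, x.2)) (by fun_prop)) (by fun_prop))
  refine h3.exists'.of_eq fun ⟨u, c, d⟩ => ⟨?_, fun h => ?_⟩
  · rintro ⟨T, hmem, hT⟩
    simp only at hmem ⊢
    induction u generalizing c with
    | nil =>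
      rcases hT _ hmem with ⟨-, h⟩ | ⟨y, h, -⟩
      · exact h
      · simp at h
    | cons l u ih =>
      rcases hT _ hmem with ⟨h, -⟩ | ⟨⟨l', u', e⟩, h, h1, h2⟩
      · simp at h
      · simp only [List.cons.injEq] at h h1 h2
        obtain ⟨rfl, rfl⟩ := h
        exact ⟨e, h1, ih e h2 hT⟩
  · simp only at h ⊢
    induction u generalizing c with
    | nil => exact ⟨[([], c, d)], by simp, by
        intro t ht
        obtain rfl := List.mem_singleton.1 ht
        exact Or.inl ⟨rfl, h⟩⟩
    | cons l u ih =>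
      obtain ⟨e, h1, h2⟩ := h
      obtain ⟨T, hmem, hT⟩ := ih e h2
      refine ⟨(l :: u, c, d) :: T, List.mem_cons_self, fun t ht => ?_⟩
      rcases List.mem_cons.1 ht with rfl | ht
      · exact Or.inr ⟨(l, u, e), rfl, h1, List.mem_cons_of_mem _ hmem⟩
      · rcases hT t ht with h | ⟨y, h, h', h''⟩
        · exact Or.inl h
        · exact Or.inr ⟨y, h, h', List.mem_cons_of_mem _ h''⟩

end Chain

/-! ### Preimages of basic balls under group elements. -/

section Action

variable {G : Type*} [Group G] {n : ℕ} (s : Fin n → G) {M : Type*} [ComputableMetricSpace M]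
  {K : Set M} [MulAction G K]

/-- The action is not assumed computable uniformly in `g`. There are finitely many generators and
inverses, so their enumerations combine into one, and chains extend it to words. -/
theorem exists_rePred_preimage
    (hf : ∀ g : G, ComputableMetricMap fun y : K => ((g • y : K) : M)) :
    ∃ E : GenWord n × (ℕ × ℕ × ℕ) × (ℕ × ℕ × ℕ) → Prop, REPred E ∧
      ∀ u c (y : K), ((wordValue s u • y : K) : M) ∈ basicBall M c ↔
        ∃ d, E (u, c, d) ∧ (y : M) ∈ basicBall M d := by
  choose E hE h using fun l : Fin n × Bool => hf (if l.2 then s l.1 else (s l.1)⁻¹)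
  have hE' := REPred.of_forall_finite hE
  refine ⟨_, rePred_relChain (E := fun l c d => E l (c, d)) hE', fun u c y => ?_⟩
  simp only
  induction u generalizing c with
  | nil => simp [RelChain]
  | cons l u ih =>
    rw [wordValue_cons, mul_smul, h]
    simp only [RelChain, ih]
    constructor
    · rintro ⟨e, he, d, hd, hy⟩
      exact ⟨d, ⟨e, he, hd⟩, hy⟩
    · rintro ⟨d, ⟨e, he, hd⟩, hy⟩
      exact ⟨e, he, d, hd, hy⟩

theorem RecursivelyCompact.rePred_word_cover (hK : RecursivelyCompact K)
    (hf : ∀ g : G, ComputableMetricMap fun y : K => ((g • y : K) : M)) {α : Type*}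
    [Primcodable α] {Q : α × (GenWord n × (ℕ × ℕ × ℕ)) → Prop} (hQ : REPred Q) :
    REPred fun a => ∀ y : K, ∃ t, Q (a, t) ∧
      ((wordValue s t.1 • y : K) : M) ∈ basicBall M t.2 := by
  obtain ⟨E, hE, h⟩ := exists_rePred_preimage s hf
  have h1 : REPred fun x : (α × (ℕ × ℕ × ℕ)) × (GenWord n × (ℕ × ℕ × ℕ)) =>
      Q (x.1.1, x.2) ∧ E (x.2.1, x.2.2, x.1.2) :=
    (hQ.comp' (by fun_prop)).and (hE.comp' (by fun_prop))
  refine (hK.rePred_cover h1.exists').of_eq fun a => forall_congr' fun y => ?_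
  simp only [h]
  constructor
  · rintro ⟨d, ⟨t, h1, h2⟩, hy⟩
    exact ⟨t, h1, d, h2, hy⟩
  · rintro ⟨t, h1, d, h2, hy⟩
    exact ⟨d, ⟨t, h1, h2⟩, hy⟩

end Action

end EffDyn

namespace EffDyn

open Encodable Topology

/-! ### Nonemptiness certificates from an effective dynamical system -/

section Certificate

variable {G : Type*} [Group G] {n : ℕ} (s : Fin n → G) {M : Type*} [ComputableMetricSpace M]
  (K : Set M) [MulAction G K]

/-- The balls labelled by pairs of an index and a bit in the list `β` cover `K` for each index that
occurs in `P`, and no point of `K` has an orbit that follows a pattern in `P` through the closures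
of the balls. -/
def Certifies (P : List (BinPattern n)) (β : List ((ℕ × Bool) × (ℕ × ℕ × ℕ))) : Prop :=
  (∀ c ∈ P.flatten, ∀ y : K, ∃ d, (∃ e ∈ β, e.1.1 = c.1.2 ∧ e.2 = d) ∧ (y : M) ∈ basicBall M d) ∧
  ∀ p ∈ P, ∀ y : K, ∃ t : GenWord n × (ℕ × ℕ × ℕ),
    (∃ c ∈ p, t.1 = invWord c.1.1 ∧ ∀ e ∈ β, e.1 ≠ (c.1.2, c.2) ∨ FarBall M t.2 e.2) ∧
      ((wordValue s t.1 • y : K) : M) ∈ basicBall M t.2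

variable {K}

theorem rePred_certifies (hK : RecursivelyCompact K)
    (hf : ∀ g : G, ComputableMetricMap fun y : K => ((g • y : K) : M)) :
    REPred fun x : List (BinPattern n) × List ((ℕ × Bool) × (ℕ × ℕ × ℕ)) =>
      Certifies s K x.1 x.2 := by
  have h1 : REPred fun x : ((List (BinPattern n) × List ((ℕ × Bool) × (ℕ × ℕ × ℕ))) ×
      ((GenWord n × ℕ) × Bool)) × (ℕ × ℕ × ℕ) => ∃ e ∈ x.1.1.2, e.1.1 = x.1.2.1.2 ∧ e.2 = x.2 := by
    refine REPred.exists_mem (p := fun (x : ((List (BinPattern n) ×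
      List ((ℕ × Bool) × (ℕ × ℕ × ℕ))) × ((GenWord n × ℕ) × Bool)) × (ℕ × ℕ × ℕ))
      (e : (ℕ × Bool) × (ℕ × ℕ × ℕ)) => e.1.1 = x.1.2.1.2 ∧ e.2 = x.2) ?_ (by fun_prop)
    exact (REPred.eq (by fun_prop) (by fun_prop)).and (REPred.eq (by fun_prop) (by fun_prop))
  have h2 : REPred fun x : ((((List (BinPattern n) × List ((ℕ × Bool) × (ℕ × ℕ × ℕ))) ×
      BinPattern n) × (GenWord n × (ℕ × ℕ × ℕ))) × ((GenWord n × ℕ) × Bool)) ×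
      ((ℕ × Bool) × (ℕ × ℕ × ℕ)) =>
      x.2.1 ≠ (x.1.2.1.2, x.1.2.2) ∨ FarBall M x.1.1.2.2 x.2.2 := by
    refine (REPred.of_primrec (PrimrecPred.not (Primrec.eq.comp ?_ ?_))).or
      ((rePred_farBall M).comp' (f := fun x : ((((List (BinPattern n) ×
        List ((ℕ × Bool) × (ℕ × ℕ × ℕ))) × BinPattern n) × (GenWord n × (ℕ × ℕ × ℕ))) ×
        ((GenWord n × ℕ) × Bool)) × ((ℕ × Bool) × (ℕ × ℕ × ℕ)) => (x.1.1.2.2, x.2.2)) ?_) <;>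
      fun_prop
  have h3 : REPred fun x : ((List (BinPattern n) × List ((ℕ × Bool) × (ℕ × ℕ × ℕ))) ×
      BinPattern n) × (GenWord n × (ℕ × ℕ × ℕ)) => ∃ c ∈ x.1.2, x.2.1 = invWord c.1.1 ∧
        ∀ e ∈ x.1.1.2, e.1 ≠ (c.1.2, c.2) ∨ FarBall M x.2.2 e.2 := by
    refine REPred.exists_mem (p := fun (x : ((List (BinPattern n) ×
      List ((ℕ × Bool) × (ℕ × ℕ × ℕ))) × BinPattern n) × (GenWord n × (ℕ × ℕ × ℕ)))
      (c : (GenWord n × ℕ) × Bool) => x.2.1 = invWord c.1.1 ∧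
        ∀ e ∈ x.1.1.2, e.1 ≠ (c.1.2, c.2) ∨ FarBall M x.2.2 e.2) ?_ (by fun_prop)
    refine (REPred.eq (by fun_prop) (by fun_prop)).and (REPred.forall_mem (p := fun
      (x : (((List (BinPattern n) × List ((ℕ × Bool) × (ℕ × ℕ × ℕ))) × BinPattern n) ×
        (GenWord n × (ℕ × ℕ × ℕ))) × ((GenWord n × ℕ) × Bool)) (e : (ℕ × Bool) × (ℕ × ℕ × ℕ)) =>
        e.1 ≠ (x.2.1.2, x.2.2) ∨ FarBall M x.1.2.2 e.2) h2 (by fun_prop))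
  refine REPred.and ?_ ?_
  · exact REPred.forall_mem (p := fun
      (x : List (BinPattern n) × List ((ℕ × Bool) × (ℕ × ℕ × ℕ))) (c : (GenWord n × ℕ) × Bool) =>
      ∀ y : K, ∃ d, (∃ e ∈ x.2, e.1.1 = c.1.2 ∧ e.2 = d) ∧ (y : M) ∈ basicBall M d)
      (hK.rePred_cover h1) (Primrec.list_flatten.comp (by fun_prop))
  · exact REPred.forall_mem (p := fun
      (x : List (BinPattern n) × List ((ℕ × Bool) × (ℕ × ℕ × ℕ))) (p : BinPattern n) =>
      ∀ y : K, ∃ t : GenWord n × (ℕ × ℕ × ℕ),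
        (∃ c ∈ p, t.1 = invWord c.1.1 ∧ ∀ e ∈ x.2, e.1 ≠ (c.1.2, c.2) ∨ FarBall M t.2 e.2) ∧
          ((wordValue s t.1 • y : K) : M) ∈ basicBall M t.2)
      (hK.rePred_word_cover s hf h3) (by fun_prop)

variable {s}

/-- Any point `y` yields a configuration: its bit at `(g, j)` is the label of some ball that
contains `g⁻¹ • y`. An occurrence of a pattern would put a point of the orbit both inside a ball
with a prescribed label and away from all such balls. -/
theorem Certifies.nonempty [Nonempty K] {P : List (BinPattern n)}
    {β : List ((ℕ × Bool) × (ℕ × ℕ × ℕ))} (h : Certifies s K P β) :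
    (binSystem s (· ∈ P)).Nonempty := by
  classical
  obtain ⟨y⟩ := ‹Nonempty K›
  let R : G → ℕ → Bool → Prop := fun g j b =>
    ∃ e ∈ β, e.1 = (j, b) ∧ ((g⁻¹ • y : K) : M) ∈ basicBall M e.2
  -- The covering clause provides a label for every index that occurs in `P`; the default `false`
  -- only fills positions that no pattern sees.
  refine ⟨fun g j => if hb : ∃ b, R g j b then hb.choose else false,
    (mem_binSystem_iff s).2 fun g p hp hx => ?_⟩
  obtain ⟨t, ⟨c, hc, ht, hfar⟩, hy⟩ := h.2 p hp (g⁻¹ • y)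
  have hg : wordValue s t.1 • g⁻¹ • y = (g * wordValue s c.1.1)⁻¹ • y := by
    rw [ht, wordValue_invWord, mul_inv_rev, mul_smul]
  rw [hg] at hy
  have hex : ∃ b, R (g * wordValue s c.1.1) c.1.2 b := by
    obtain ⟨d, ⟨e, he, hj, rfl⟩, hd⟩ := h.1 c (List.mem_flatten.2 ⟨p, hp, hc⟩)
      ((g * wordValue s c.1.1)⁻¹ • y)
    exact ⟨e.1.2, e, he, by rw [← hj], hd⟩
  have hxc := hx c hc
  rw [dif_pos hex] at hxc
  obtain ⟨e, he, heq, hball⟩ := hex.choose_spec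
  rw [hxc] at heq
  rcases hfar e he with h' | h'
  · exact h' heq
  · exact absurd (h'.lt_dist hy) (not_lt.2 (mem_basicBall_iff.1 hball).le)

/-- A clopen subset of a compact set is covered by finitely many basic balls whose closures meet
the compact set inside of the clopen subset. -/
theorem exists_ball_cover (hK : IsCompact K) {C : Set K} (hC : IsClopen C) :
    ∃ l : List (ℕ × ℕ × ℕ), (∀ y ∈ C, ∃ c ∈ l, (y : M) ∈ basicBall M c) ∧
      ∀ c ∈ l, ∀ y ∉ C, ballRadius c < dist (y : M) (ComputableMetricSpace.pt c.1) := by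
  have : CompactSpace K := isCompact_iff_compactSpace.1 hK
  let good : Set (ℕ × ℕ × ℕ) :=
    {c | ∀ y ∉ C, ballRadius c < dist (y : M) (ComputableMetricSpace.pt c.1)}
  obtain ⟨t, ht⟩ := hC.1.isCompact.elim_finite_subcover
    (fun c : good => ((↑) : K → M) ⁻¹' basicBall M c.1)
    (fun c => (isOpen_basicBall c.1).preimage continuous_subtype_val) (by
      intro y hy
      obtain ⟨ε, hε, hball⟩ := Metric.isOpen_iff.1 hC.2 y hy
      obtain ⟨i, b, hyb, hb⟩ := exists_basicBall_small (y : M) (half_pos hε)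
      refine Set.mem_iUnion.2 ⟨⟨(i, 1, b), fun z hz => ?_⟩, hyb⟩
      have hyz : ε ≤ dist z y := by
        by_contra! h
        exact hz (hball h)
      rw [mem_basicBall_iff] at hyb
      have e : ballRadius (i, 1, b) = 1 / ((b : ℝ) + 1) := by simp [ballRadius]
      rw [e] at hyb ⊢
      have := dist_triangle_right (z : M) (y : M) (ComputableMetricSpace.pt i)
      rw [Subtype.dist_eq] at hyz
      simp only at hyb ⊢
      linarith)
  refine ⟨t.toList.map Subtype.val, fun y hy => ?_, fun c hc => ?_⟩
  · obtain ⟨c, hc, hyc⟩ := Set.mem_iUnion₂.1 (ht hy)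
    exact ⟨c.1, List.mem_map.2 ⟨c, by simpa using hc, rfl⟩, hyc⟩
  · obtain ⟨c, -, rfl⟩ := List.mem_map.1 hc
    exact c.2

/-- Balls are chosen inside the clopen sets where `φ` has a given bit at the identity. By
equivariance, the bit of `φ y` at `w` is the bit at the identity of the image of the translate of
`y` by the inverse of `w`. -/
theorem exists_certifies (hK : IsCompact K) {P : List (BinPattern n)}
    {φ : K → binSystem s (· ∈ P)} (hφ : Continuous φ) (heq : ∀ (g : G) y, φ (g • y) = g • φ y) :
    ∃ β, Certifies s K P β := by
  have hclopen : ∀ j b, IsClopen {y : K | (φ y).1 1 j = b} := fun j b =>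
    (isClopen_discrete {b}).preimage ((continuous_apply j).comp ((continuous_apply (1 : G)).comp
      (continuous_subtype_val.comp hφ)))
  choose ℓ hcov hfar using fun j b => exists_ball_cover hK (hclopen j b)
  have hval : ∀ (w : GenWord n) y j, (φ (wordValue s (invWord w) • y)).1 1 j =
      (φ y).1 (wordValue s w) j := by
    intro w y j
    rw [heq, binSystem_smul_apply, wordValue_invWord, inv_inv, mul_one]
  refine ⟨P.flatten.flatMap fun c => [true, false].flatMap fun b =>
    (ℓ c.1.2 b).map fun d => ((c.1.2, b), d), fun c hc y => ?_, fun p hp y => ?_⟩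
  · obtain ⟨d, hd, hy⟩ := hcov c.1.2 ((φ y).1 1 c.1.2) y rfl
    refine ⟨d, ⟨((c.1.2, (φ y).1 1 c.1.2), d), ?_, rfl, rfl⟩, hy⟩
    refine List.mem_flatMap.2 ⟨c, hc, List.mem_flatMap.2 ⟨(φ y).1 1 c.1.2, ?_,
      List.mem_map.2 ⟨d, hd, rfl⟩⟩⟩
    cases (φ y).1 1 c.1.2 <;> simp
  -- Some entry of `p` is violated by `φ y`, so the corresponding translate of `y` lies outside of
  -- the clopen set of that label and has a neighborhood far from all its balls.
  · obtain ⟨c, hc, hne⟩ := (φ y).2 1 p hp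
    rw [one_mul] at hne
    obtain ⟨d, hd, hd'⟩ := exists_farBall (l := ℓ c.1.2 c.2)
      (z := ((wordValue s (invWord c.1.1) • y : K) : M)) fun e he =>
        hfar c.1.2 c.2 e he _ (by
          change ¬ _ = _
          rwa [hval])
    refine ⟨(invWord c.1.1, d), ⟨c, hc, rfl, fun e he => ?_⟩, hd⟩
    obtain ⟨c', -, he⟩ := List.mem_flatMap.1 he
    obtain ⟨b, -, he⟩ := List.mem_flatMap.1 he
    obtain ⟨d', hd'', rfl⟩ := List.mem_map.1 he
    by_cases h : (c'.1.2, b) = (c.1.2, c.2)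
    · simp only [Prod.mk.injEq] at h
      rw [h.1, h.2] at hd''
      exact Or.inr (hd' _ hd'')
    · exact Or.inl h

end Certificate

/-- If all nonempty binary systems of finite type are images of one effective dynamical system, then
their nonemptiness is decidable. -/
theorem decidableBinaryDomino_of_factors {G : Type*} [Group G] {n : ℕ} {s : Fin n → G}
    (hs : Subgroup.closure (Set.range s) = ⊤) (hWP : DecidableWordProblem s) {U : Type*}
    [TopologicalSpace U] [MulAction G U] [Nonempty U] (hU : IsEDS G U)
    (hfac : ∀ P : List (BinPattern n), (binSystem s (· ∈ P)).Nonempty →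
      ∃ f : U → binSystem s (· ∈ P), Continuous f ∧ ∀ (g : G) x, f (g • x) = g • f x) :
    DecidableBinaryDomino s := by
  obtain ⟨M, _, K, _, hK, hf, e, he⟩ := hU
  have : Nonempty K := Nonempty.map e ‹_›
  classical
  refine ComputablePred.computable_iff_re_compl_re.2 ⟨?_, ?_⟩
  · refine (rePred_certifies s hK hf).exists'.of_eq fun P => ⟨?_, fun h => ?_⟩
    · rintro ⟨β, hβ⟩
      exact Certifies.nonempty hβ
    · obtain ⟨f, hfc, hfe⟩ := hfac P h
      refine exists_certifies hK.1 (φ := fun y => f (e.symm y)) (hfc.comp e.symm.continuous)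
        fun g y => ?_
      rw [← hfe]
      congr 1
      rw [Homeomorph.symm_apply_eq, he, Homeomorph.apply_symm_apply]
  · exact rePred_binSystem_eq_empty hs hWP (P := fun P p => p ∈ P)
      (REPred.mem (by fun_prop) (by fun_prop))

end EffDyn

namespace EffDyn

open Encodable Topology

/-! ### Binary systems that factor onto a given effective dynamical system -/

theorem ComputableMetricMap.continuous {M : Type*} [ComputableMetricSpace M] {K : Set M}
    {f : K → M} (hf : ComputableMetricMap f) : Continuous f := by
  obtain ⟨E, -, h⟩ := hf
  have hball : ∀ c, IsOpen (f ⁻¹' basicBall M c) := by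
    intro c
    have : f ⁻¹' basicBall M c = ⋃ d ∈ {d | E (c, d)}, ((↑) : K → M) ⁻¹' basicBall M d := by
      ext x
      simp only [Set.mem_preimage, h, Set.mem_iUnion, Set.mem_ofPred_eq, exists_prop]
    rw [this]
    exact isOpen_iUnion fun d => isOpen_iUnion fun _ =>
      (isOpen_basicBall d).preimage continuous_subtype_val
  refine continuous_def.2 fun V hV => isOpen_iff_mem_nhds.2 fun x hx => ?_
  obtain ⟨ε, hε, hεV⟩ := Metric.isOpen_iff.1 hV (f x) hx
  obtain ⟨i, b, hxb, hb⟩ := exists_basicBall_small (f x) (half_pos hε)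
  refine Filter.mem_of_superset ((hball (i, 1, b)).mem_nhds hxb) fun y hy => hεV ?_
  rw [Set.mem_preimage, mem_basicBall_iff] at hy
  rw [mem_basicBall_iff] at hxb
  have e : ballRadius (i, 1, b) = 1 / ((b : ℝ) + 1) := by simp [ballRadius]
  rw [e] at hy hxb
  have := dist_triangle_right (f y) (f x) (ComputableMetricSpace.pt i)
  rw [Metric.mem_ball]
  simp only at hy hxb
  linarith

section Tracking

variable {G : Type*} [Group G] {n : ℕ} (s : Fin n → G) {M : Type*} [ComputableMetricSpace M]
  (K : Set M) [MulAction G K]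

/-- The index of a basic ball with a given code. -/
def ballIndex (j : ℕ) : ℕ × ℕ × ℕ := (decode j).getD (0, 0, 0)

@[fun_prop] theorem primrec_ballIndex {α : Type*} [Primcodable α] {f : α → ℕ}
    (hf : Primrec f) : Primrec fun a => ballIndex (f a) :=
  Primrec.option_getD.comp (Primrec.decode.comp hf) (Primrec.const _)

/-- The index of a concentric larger ball. -/
def enlarge (c : ℕ × ℕ × ℕ) : ℕ × ℕ × ℕ := (c.1, c.2.1 + 1, c.2.2)

@[fun_prop] theorem primrec_enlarge {α : Type*} [Primcodable α] {f : α → ℕ × ℕ × ℕ}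
    (hf : Primrec f) : Primrec fun a => enlarge (f a) := by
  unfold enlarge
  fun_prop

/-- The value `b` of the `j`-th bit excludes the point `z`: the bit `false` excludes the points of
the `j`-th basic ball, and `true` excludes those outside of a larger closed ball. -/
def Excludes (j : ℕ) (b : Bool) (z : M) : Prop :=
  (b = false → z ∈ basicBall M (ballIndex j)) ∧ (b = true → ballRadius (enlarge (ballIndex j)) <
    dist z (ComputableMetricSpace.pt (ballIndex j).1))

variable (M) in
/-- The basic ball with index `d` consists of points that are excluded by the value `b` of the
`j`-th bit. -/
def ExcludesBall (j : ℕ) (b : Bool) (d : ℕ × ℕ × ℕ) : Prop :=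
  (b = false ∧ d = ballIndex j) ∨ (b = true ∧ FarBall M d (enlarge (ballIndex j)))

/-- Both exclusions are open and visible on basic balls. The margin between the ball and its
enlargement makes this possible while still leaving an admissible bit for each point. -/
theorem excludes_iff {j : ℕ} {b : Bool} {z : M} :
    Excludes j b z ↔ ∃ d, ExcludesBall M j b d ∧ z ∈ basicBall M d := by
  cases b
  · simp [Excludes, ExcludesBall]
  · simp only [Excludes, ExcludesBall, Bool.true_eq_false, false_implies, true_implies, true_and,
      false_and, false_or]
    constructor
    · intro h
      obtain ⟨d, hz, hd⟩ := exists_farBall (l := [enlarge (ballIndex j)]) (z := z) (by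
        intro c hc
        obtain rfl := List.mem_singleton.1 hc
        exact h)
      exact ⟨d, hd _ (by simp), hz⟩
    · rintro ⟨d, hd, hz⟩
      exact hd.lt_dist hz

theorem isOpen_excludes (j : ℕ) (b : Bool) : IsOpen {z : M | Excludes j b z} := by
  have : {z : M | Excludes j b z} = ⋃ d ∈ {d | ExcludesBall M j b d}, basicBall M d := by
    ext z
    simp [excludes_iff]
  rw [this]
  exact isOpen_iUnion fun d => isOpen_iUnion fun _ => isOpen_basicBall d

/-- The patterns which no orbit in `K` is allowed to follow. -/
def trackingPatterns (p : BinPattern n) : Prop :=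
  ∀ y : K, ∃ t : GenWord n × (ℕ × ℕ × ℕ),
    (∃ c ∈ p, t.1 = invWord c.1.1 ∧ ExcludesBall M c.1.2 c.2 t.2) ∧
      ((wordValue s t.1 • y : K) : M) ∈ basicBall M t.2

variable {K}

theorem trackingPatterns_iff {p : BinPattern n} : trackingPatterns s K p ↔
    ∀ y : K, ∃ c ∈ p, Excludes c.1.2 c.2 (((wordValue s c.1.1)⁻¹ • y : K) : M) := by
  refine forall_congr' fun y => ?_
  simp only [excludes_iff]
  constructor
  · rintro ⟨⟨u, d⟩, ⟨c, hc, rfl, hd⟩, hy⟩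
    exact ⟨c, hc, d, hd, by rwa [wordValue_invWord] at hy⟩
  · rintro ⟨c, hc, d, hd, hy⟩
    exact ⟨(invWord c.1.1, d), ⟨c, hc, rfl, hd⟩, by rwa [wordValue_invWord]⟩

theorem rePred_trackingPatterns (hK : RecursivelyCompact K)
    (hf : ∀ g : G, ComputableMetricMap fun y : K => ((g • y : K) : M)) :
    REPred (trackingPatterns s K) := by
  refine hK.rePred_word_cover s hf (Q := fun x : BinPattern n × (GenWord n × (ℕ × ℕ × ℕ)) =>
    ∃ c ∈ x.1, x.2.1 = invWord c.1.1 ∧ ExcludesBall M c.1.2 c.2 x.2.2) ?_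
  refine REPred.exists_mem (p := fun (x : BinPattern n × (GenWord n × (ℕ × ℕ × ℕ)))
    (c : (GenWord n × ℕ) × Bool) => x.2.1 = invWord c.1.1 ∧ ExcludesBall M c.1.2 c.2 x.2.2) ?_
    (by fun_prop)
  refine (REPred.eq ?_ ?_).and (((REPred.eq ?_ ?_).and (REPred.eq ?_ ?_)).or
    ((REPred.eq ?_ ?_).and ((rePred_farBall M).comp' (f := fun x : (BinPattern n ×
      (GenWord n × (ℕ × ℕ × ℕ))) × ((GenWord n × ℕ) × Bool) =>
      (x.1.2.2, enlarge (ballIndex x.2.1.2))) ?_))) <;> fun_prop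

/-- The bits of the configuration `x` do not exclude the corresponding points of the orbit
of `y`. -/
def Tracks (x : G → ℕ → Bool) (y : K) : Prop :=
  ∀ g j, ¬ Excludes j (x g j) ((g⁻¹ • y : K) : M)

/-- Take a ball of radius below ε/3 around `y`. Its bit at the identity cannot be `false`, so `z`
lies in the closed ball of twice the radius. -/
theorem Tracks.unique {x : G → ℕ → Bool} {y z : K} (hy : Tracks x y) (hz : Tracks x z) :
    y = z := by
  refine Subtype.ext (eq_of_forall_dist_le fun ε hε => ?_)
  obtain ⟨i, b, hyb, hb⟩ := exists_basicBall_small (y : M) (show 0 < ε / 3 by positivity)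
  have hj : ballIndex (encode (i, 1, b)) = (i, 1, b) := by
    rw [ballIndex, encodek]
    rfl
  have h1 := hy 1 (encode (i, 1, b))
  have h2 := hz 1 (encode (i, 1, b))
  rw [inv_one, one_smul, Excludes, hj] at h1 h2
  cases hbit : x 1 (encode (i, 1, b)) with
  | false => exact absurd ⟨fun _ => hyb, fun h => by rw [hbit] at h; exact absurd h (by decide)⟩ h1
  | true =>
    simp only [hbit, Bool.true_eq_false, false_implies, true_implies, true_and, not_lt] at h2
    rw [mem_basicBall_iff] at hyb
    have e1 : ballRadius (i, 1, b) = 1 / ((b : ℝ) + 1) := by simp [ballRadius]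
    have e2 : ballRadius (enlarge (i, 1, b)) = 2 * (1 / ((b : ℝ) + 1)) := by
      simp only [ballRadius, enlarge]
      push_cast
      ring
    rw [e1] at hyb
    rw [e2] at h2
    have := dist_triangle_right (y : M) (z : M) (ComputableMetricSpace.pt i)
    simp only at hyb
    linarith

theorem Tracks.smul {P : BinPattern n → Prop} {x : binSystem s P} {y : K} (h : Tracks x.1 y)
    (a : G) : Tracks (a • x).1 (a • y) := by
  intro g j
  rw [binSystem_smul_apply, ← mul_smul]
  simpa using h (a⁻¹ * g) j

theorem Tracks.mem_binSystem {x : G → ℕ → Bool} {y : K} (h : Tracks x y) :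
    x ∈ binSystem s (trackingPatterns s K) := by
  refine (mem_binSystem_iff s).2 fun g p hp hx => ?_
  obtain ⟨c, hc, hex⟩ := (trackingPatterns_iff s).1 hp (g⁻¹ • y)
  rw [← hx c hc, ← mul_smul, ← mul_inv_rev] at hex
  exact h _ _ hex

theorem exists_tracks (y : K) : ∃ x : G → ℕ → Bool, Tracks x y := by
  classical
  refine ⟨fun g j => decide (((g⁻¹ • y : K) : M) ∈ basicBall M (ballIndex j)), fun g j h => ?_⟩
  by_cases hb : ((g⁻¹ • y : K) : M) ∈ basicBall M (ballIndex j)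
  · have h2 := h.2 (by simp [hb])
    rw [mem_basicBall_iff] at hb
    have : ballRadius (ballIndex j) ≤ ballRadius (enlarge (ballIndex j)) := by
      simp only [ballRadius, enlarge]
      push_cast
      gcongr
      linarith
    linarith
  · exact hb (h.1 (by simp [hb]))

variable {s}

/-- If the bits of `x` excluded every point, finitely many of them would do so by compactness, and
these form a forbidden pattern that occurs in `x`. -/
theorem exists_tracks_of_mem_binSystem (hs : Subgroup.closure (Set.range s) = ⊤)
    (hK : IsCompact K) (hf : ∀ g : G, Continuous fun y : K => ((g • y : K) : M))
    {x : G → ℕ → Bool} (hx : x ∈ binSystem s (trackingPatterns s K)) : ∃ y : K, Tracks x y := by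
  have : CompactSpace K := isCompact_iff_compactSpace.1 hK
  by_contra! H
  obtain ⟨t, ht⟩ := isCompact_univ.elim_finite_subcover
    (fun c : GenWord n × ℕ => {y : K | Excludes c.2 (x (wordValue s c.1) c.2)
      (((wordValue s c.1)⁻¹ • y : K) : M)})
    (fun c => (isOpen_excludes _ _).preimage (hf _)) (by
      intro y _
      have := H y
      simp only [Tracks, not_forall, not_not] at this
      obtain ⟨g, j, h⟩ := this
      obtain ⟨w, rfl⟩ := wordValue_surjective hs g
      exact Set.mem_iUnion.2 ⟨(w, j), h⟩)
  refine (mem_binSystem_iff s).1 hx 1 (t.toList.map fun c => (c, x (wordValue s c.1) c.2)) ?_ ?_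
  · refine (trackingPatterns_iff s).2 fun y => ?_
    obtain ⟨c, hc, hy⟩ := Set.mem_iUnion₂.1 (ht (Set.mem_univ y))
    exact ⟨_, List.mem_map.2 ⟨c, by simpa using hc, rfl⟩, hy⟩
  · intro c hc
    obtain ⟨c, -, rfl⟩ := List.mem_map.1 hc
    simp

theorem isClosed_tracks (P : BinPattern n → Prop)
    (hf : ∀ g : G, Continuous fun y : K => ((g • y : K) : M)) :
    IsClosed {a : binSystem s P × K | Tracks a.1.1 a.2} := by
  have : {a : binSystem s P × K | Tracks a.1.1 a.2} = ⋂ (g : G) (j : ℕ) (b : Bool),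
      {a : binSystem s P × K | a.1.1 g j = b → ¬ Excludes j b ((g⁻¹ • a.2 : K) : M)} := by
    ext a
    simp only [Set.mem_iInter, Set.mem_ofPred_eq, Tracks]
    exact ⟨fun h g j b hb => hb ▸ h g j, fun h g j => h g j _ rfl⟩
  rw [this]
  refine isClosed_iInter fun g => isClosed_iInter fun j => isClosed_iInter fun b => ?_
  refine isClosed_imp ?_ ?_
  · exact (isOpen_discrete {b}).preimage ((continuous_apply (A := fun _ : ℕ => Bool) j).comp ((continuous_apply g).comp
      (continuous_subtype_val.comp continuous_fst)))
  · exact ((isOpen_excludes j b).preimage ((hf g⁻¹).comp continuous_snd)).isClosed_compl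

/-- The map sends a configuration to the unique point it tracks. Its graph is closed and `K` is
compact, so preimages of closed sets are closed as projections along `K`. -/
theorem exists_factor_of_recursivelyCompact (hs : Subgroup.closure (Set.range s) = ⊤)
    (hK : IsCompact K) (hf : ∀ g : G, Continuous fun y : K => ((g • y : K) : M)) :
    ∃ f : binSystem s (trackingPatterns s K) → K, IsFactorMap G f := by
  have : CompactSpace K := isCompact_iff_compactSpace.1 hK
  choose f h using fun x : binSystem s (trackingPatterns s K) =>
    exists_tracks_of_mem_binSystem hs hK hf x.2
  refine ⟨f, ?_, fun y => ?_, fun g x => ?_⟩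
  · refine continuous_iff_isClosed.2 fun C hC => ?_
    have : f ⁻¹' C = Prod.fst '' ({a : binSystem s (trackingPatterns s K) × K |
        Tracks a.1.1 a.2} ∩ Prod.snd ⁻¹' C) := by
      ext x
      constructor
      · intro hx
        exact ⟨(x, f x), ⟨h x, hx⟩, rfl⟩
      · rintro ⟨⟨x, y⟩, ⟨hxy, hy⟩, rfl⟩
        rw [Set.mem_preimage, (h x).unique hxy]
        exact hy
    rw [this]
    exact isClosedMap_fst_of_compactSpace _
      ((isClosed_tracks _ hf).inter (hC.preimage continuous_snd))
  · obtain ⟨x, hx⟩ := exists_tracks (G := G) y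
    exact ⟨⟨x, hx.mem_binSystem s⟩, (h _).unique hx⟩
  · exact (h _).unique ((h x).smul s g)

end Tracking

theorem IsEDS.exists_binSystem_factor {G : Type*} [Group G] {n : ℕ} {s : Fin n → G}
    (hs : Subgroup.closure (Set.range s) = ⊤) {X : Type*} [TopologicalSpace X] [MulAction G X]
    (hX : IsEDS G X) : ∃ P : BinPattern n → Prop, REPred P ∧
      ∃ f : binSystem s P → X, IsFactorMap G f := by
  obtain ⟨M, _, K, _, hK, hf, e, he⟩ := hX
  obtain ⟨f, hfc, hfs, hfe⟩ := exists_factor_of_recursivelyCompact hs hK.1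
    fun g => (hf g).continuous
  refine ⟨_, rePred_trackingPatterns s hK hf, fun x => e.symm (f x), e.symm.continuous.comp hfc,
    e.symm.surjective.comp hfs, fun g x => ?_⟩
  change e.symm (f (g • x)) = g • e.symm (f x)
  rw [hfe, Homeomorph.symm_apply_eq, he, Homeomorph.apply_symm_apply]

end EffDyn

namespace EffDyn

open Encodable Topology

/-! ### The universal system -/

/-! ### Greedy selection from a sequence of candidates. -/

section Greedy

variable {β : Type*} (f : List β → Bool) (cand : ℕ → β)

/-- Add the candidates one by one as long as the test `f` succeeds. -/
def greedy (t : ℕ) : List β :=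
  t.rec [] fun k l => bif f (cand k :: l) then cand k :: l else l

theorem greedy_succ (t : ℕ) : greedy f cand (t + 1) =
    bif f (cand t :: greedy f cand t) then cand t :: greedy f cand t else greedy f cand t := rfl

theorem greedy_subset_succ (t : ℕ) : greedy f cand t ⊆ greedy f cand (t + 1) := by
  rw [greedy_succ]
  cases f (cand t :: greedy f cand t)
  · exact List.Subset.refl _
  · exact List.subset_cons_self _ _

theorem apply_greedy (h0 : f [] = true) (t : ℕ) : f (greedy f cand t) = true := by
  induction t with
  | zero => exact h0
  | succ t ih =>
    rw [greedy_succ]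
    cases h : f (cand t :: greedy f cand t)
    · exact ih
    · exact h

variable {f cand}

theorem exists_of_mem_greedy {t : ℕ} {b : β} (h : b ∈ greedy f cand t) : ∃ k, b = cand k := by
  induction t with
  | zero => simp [greedy] at h
  | succ t ih =>
    rw [greedy_succ] at h
    cases hf : f (cand t :: greedy f cand t) <;> rw [hf] at h
    · exact ih h
    · rcases List.mem_cons.1 h with rfl | h
      · exact ⟨t, rfl⟩
      · exact ih h

/-- When the test passes on all lists of candidates, nothing is ever rejected. -/
theorem mem_greedy_of_forall (h : ∀ l : List β, (∀ b ∈ l, ∃ k, b = cand k) → f l = true) (k : ℕ) :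
    cand k ∈ greedy f cand (k + 1) := by
  rw [greedy_succ, h]
  · exact List.mem_cons_self
  · intro b hb
    rcases List.mem_cons.1 hb with rfl | hb
    · exact ⟨k, rfl⟩
    · exact exists_of_mem_greedy hb

end Greedy

section Universal

variable {G : Type*} [Group G] {n : ℕ} (s : Fin n → G)

theorem binSystem_mono {P Q : BinPattern n → Prop} (h : ∀ p, P p → Q p) :
    binSystem s Q ⊆ binSystem s P := fun _ hx g p hp => hx g p (h p hp)

theorem isClosed_binSystem (P : BinPattern n → Prop) : IsClosed (binSystem s P) := by
  have : binSystem s P = ⋂ (g : G) (p : BinPattern n) (_ : P p),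
      {x | ∃ c ∈ p, x (g * wordValue s c.1.1) c.1.2 ≠ c.2} := by
    ext x
    simp only [binSystem, Set.mem_iInter, Set.mem_ofPred_eq]
  rw [this]
  refine isClosed_iInter fun g => isClosed_iInter fun p => isClosed_iInter fun _ => ?_
  have : {x : G → ℕ → Bool | ∃ c ∈ p, x (g * wordValue s c.1.1) c.1.2 ≠ c.2} =
      ⋃ c ∈ {c | c ∈ p}, {x : G → ℕ → Bool | x (g * wordValue s c.1.1) c.1.2 ≠ c.2} := by
    ext x
    simp only [Set.mem_iUnion, Set.mem_ofPred_eq, exists_prop]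
  rw [this]
  refine (List.finite_toSet p).isClosed_biUnion fun c _ => ?_
  exact (isClosed_discrete {c.2}ᶜ).preimage ((continuous_apply (A := fun _ : ℕ => Bool) c.1.2).comp
    (continuous_apply (A := fun _ : G => ℕ → Bool) (g * wordValue s c.1.1)))

/-- The union of an increasing sequence of finite sets of patterns with nonempty systems has a
nonempty system. -/
theorem nonempty_binSystem_iUnion {l : ℕ → List (BinPattern n)} (hl : ∀ t, l t ⊆ l (t + 1))
    (h : ∀ t, (binSystem s (· ∈ l t)).Nonempty) : (binSystem s fun p => ∃ t, p ∈ l t).Nonempty := by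
  obtain ⟨x, hx⟩ := IsCompact.nonempty_iInter_of_sequence_nonempty_isCompact_isClosed
    (fun t => binSystem s (· ∈ l t)) (fun t => binSystem_mono s fun p hp => hl t hp) h
    (isClosed_binSystem s _).isCompact (fun t => isClosed_binSystem s _)
  refine ⟨x, fun g p ⟨t, ht⟩ => ?_⟩
  exact Set.mem_iInter.1 hx t g p ht

variable (n) in
/-- A pattern that occurs in no configuration. -/
def inconsistentPattern : BinPattern n := [(([], 0), true), (([], 0), false)]

variable (n) in
/-- The `t`-th pattern in the enumeration of the domain of the `i`-th partial recursive function. -/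
def candidate (i t : ℕ) : BinPattern n :=
  bif (Nat.Partrec.Code.evaln t.unpair.1 (Denumerable.ofNat Nat.Partrec.Code i)
    t.unpair.2).isSome then (decode t.unpair.2).getD (inconsistentPattern n)
  else inconsistentPattern n

theorem primrec_candidate : Primrec₂ (candidate n) := by
  refine Primrec.cond (Primrec.option_isSome.comp (Nat.Partrec.Code.primrec_evaln.comp
    (Primrec.pair (Primrec.pair ?_ ((Primrec.ofNat _).comp Primrec.fst)) ?_)))
    (Primrec.option_getD.comp (Primrec.decode.comp ?_) (Primrec.const _)) (Primrec.const _)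
  · exact Primrec.fst.comp (Primrec.unpair.comp Primrec.snd)
  · exact Primrec.snd.comp (Primrec.unpair.comp Primrec.snd)
  · exact Primrec.snd.comp (Primrec.unpair.comp Primrec.snd)

/-- The step `t` codes a fuel and a pattern. Failed steps return the inconsistent pattern, which
keeps the enumeration total, even for empty `P`, and does not change the system. -/
theorem exists_candidate {P : BinPattern n → Prop} (hP : REPred P) :
    ∃ i, (∀ t, P (candidate n i t) ∨ candidate n i t = inconsistentPattern n) ∧
      ∀ p, P p → ∃ t, p = candidate n i t := by
  obtain ⟨c, hc⟩ := Nat.Partrec.Code.exists_code.1 hP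
  have hdom : ∀ m, (Nat.Partrec.Code.eval c m).Dom ↔ ∃ p, decode m = some p ∧ P p := by
    intro m
    rw [hc]
    cases h : decode (α := BinPattern n) m <;> simp [Part.assert, h]
  refine ⟨encode c, fun t => ?_, fun p hp => ?_⟩
  · rw [candidate, Denumerable.ofNat_encode]
    cases h : (Nat.Partrec.Code.evaln t.unpair.1 c t.unpair.2) with
    | none => exact Or.inr rfl
    | some a =>
      left
      have ha : a ∈ Nat.Partrec.Code.eval c t.unpair.2 := Nat.Partrec.Code.evaln_sound h
      obtain ⟨p, hp, hp'⟩ := (hdom _).1 (Part.dom_iff_mem.2 ⟨a, ha⟩)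
      simpa [hp] using hp'
  · obtain ⟨a, ha⟩ := Part.dom_iff_mem.1 ((hdom (encode p)).2 ⟨p, encodek p, hp⟩)
    obtain ⟨k, hk⟩ := Nat.Partrec.Code.evaln_complete.1 ha
    refine ⟨Nat.pair k (encode p), ?_⟩
    rw [candidate, Denumerable.ofNat_encode, Nat.unpair_pair]
    simp only [Option.mem_def.1 hk, encodek]
    rfl

theorem binSystem_candidate {P : BinPattern n → Prop} {i : ℕ}
    (h : (∀ t, P (candidate n i t) ∨ candidate n i t = inconsistentPattern n) ∧
      ∀ p, P p → ∃ t, p = candidate n i t) :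
    binSystem s (fun p => ∃ t, p = candidate n i t) = binSystem s P := by
  refine Set.Subset.antisymm (binSystem_mono s h.2) fun x hx g p ⟨t, ht⟩ => ?_
  rcases h.1 t with h' | h'
  · exact hx g p (ht ▸ h')
  · rw [ht, h']
    cases hb : x (g * wordValue s []) 0 with
    | false => exact ⟨(([], 0), true), by simp [inconsistentPattern], by simpa using hb⟩
    | true => exact ⟨(([], 0), false), by simp [inconsistentPattern], by simpa using hb⟩

/-- Move a pattern to the `i`-th copy of the index set. -/
def movePattern (i : ℕ) (p : BinPattern n) : BinPattern n :=
  p.map fun c => ((c.1.1, Nat.pair i c.1.2), c.2)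

theorem primrec_movePattern : Primrec₂ (movePattern (n := n)) := by
  refine Primrec.list_map Primrec.snd (Primrec.pair (Primrec.pair (by fun_prop)
    (Primrec₂.natPair.comp ?_ ?_)) ?_) <;> fun_prop

/-- The `i`-th component of a configuration. -/
def component (i : ℕ) (x : G → ℕ → Bool) : G → ℕ → Bool := fun g j => x g (Nat.pair i j)

/-- Different `i` concern disjoint sets of bit indices, so the moved patterns define the product of
the systems of the `Q i`. -/
theorem mem_binSystem_movePattern {Q : ℕ → BinPattern n → Prop} {x : G → ℕ → Bool} :
    x ∈ binSystem s (fun p => ∃ i q, Q i q ∧ p = movePattern i q) ↔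
      ∀ i, component i x ∈ binSystem s (Q i) := by
  constructor
  · intro hx i g q hq
    obtain ⟨c, hc, hne⟩ := hx g (movePattern i q) ⟨i, q, hq, rfl⟩
    obtain ⟨c, hc', rfl⟩ := List.mem_map.1 hc
    exact ⟨c, hc', hne⟩
  · rintro hx g p ⟨i, q, hq, rfl⟩
    obtain ⟨c, hc, hne⟩ := hx i g q hq
    exact ⟨_, List.mem_map.2 ⟨c, hc, rfl⟩, hne⟩

variable {s}

/-- If the domino problem is decidable, some recursively enumerable set of patterns has a nonempty
system that factors onto all such systems. -/
theorem exists_universal_binSystem (hdom : DecidableBinaryDomino s) :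
    ∃ Q : BinPattern n → Prop, REPred Q ∧ (binSystem s Q).Nonempty ∧
      ∀ P : BinPattern n → Prop, REPred P → (binSystem s P).Nonempty →
        ∃ f : binSystem s Q → binSystem s P, IsFactorMap G f := by
  obtain ⟨f, hf, hfP⟩ := ComputablePred.computable_iff.1 hdom
  have hfP : ∀ P : List (BinPattern n), (binSystem s (· ∈ P)).Nonempty ↔ f P = true :=
    fun P => iff_of_eq (congr_fun hfP P)
  have h0 : f [] = true := (hfP []).1 ⟨fun _ _ => false, fun g p hp => by simp at hp⟩
  -- The decision procedure `f` is the test, so every finite stage keeps a nonempty system.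
  let L : ℕ → ℕ → List (BinPattern n) := fun i t => greedy f (candidate n i) t
  let Q : ℕ → BinPattern n → Prop := fun i q => ∃ t, q ∈ L i t
  have hne : ∀ i, (binSystem s (Q i)).Nonempty := fun i =>
    nonempty_binSystem_iUnion s (fun t => greedy_subset_succ f _ t)
      fun t => (hfP _).2 (apply_greedy f _ h0 t)
  have hL : Computable fun c : ℕ × ℕ => L c.1 c.2 := by
    have hc : Computable₂ fun (c : ℕ × ℕ) (p : ℕ × List (BinPattern n)) =>
        candidate n c.1 p.1 :: p.2 :=
      Primrec.to_comp (Primrec.list_cons.comp (primrec_candidate.comp (by fun_prop)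
        (by fun_prop)) (by fun_prop))
    refine Computable.nat_rec (f := fun c : ℕ × ℕ => c.2) (g := fun _ => [])
      (h := fun c p => bif f (candidate n c.1 p.1 :: p.2) then candidate n c.1 p.1 :: p.2 else p.2)
      Computable.snd (Computable.const []) ?_
    exact Computable.cond (hf.comp hc) hc (Computable.snd.comp Computable.snd)
  refine ⟨fun p => ∃ i q, Q i q ∧ p = movePattern i q, ?_, ?_, fun P hP hPne => ?_⟩
  · have h1 : REPred fun x : ((BinPattern n × ℕ) × BinPattern n) × ℕ => x.1.2 ∈ L x.1.1.2 x.2 :=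
      (REPred.mem (f := fun a : BinPattern n × List (BinPattern n) => a.1) (l := fun a => a.2)
        (by fun_prop) (by fun_prop)).comp
        (f := fun x : ((BinPattern n × ℕ) × BinPattern n) × ℕ => (x.1.2, L x.1.1.2 x.2))
        ((Primrec.to_comp (by fun_prop)).pair (hL.comp (f := fun c : ℕ × ℕ => L c.1 c.2)
          (g := fun x : ((BinPattern n × ℕ) × BinPattern n) × ℕ => (x.1.1.2, x.2))
          (Primrec.to_comp (by fun_prop))))
    have h2 : REPred fun x : (BinPattern n × ℕ) × BinPattern n =>
        x.1.1 = movePattern x.1.2 x.2 :=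
      .eq (by fun_prop) (primrec_movePattern.comp (by fun_prop) (by fun_prop))
    exact (h1.exists'.and h2).exists'.exists'
  · choose x hx using hne
    refine ⟨fun g j => x j.unpair.1 g j.unpair.2, (mem_binSystem_movePattern s).2 fun i => ?_⟩
    have : component i (fun g j => x j.unpair.1 g j.unpair.2) = x i := by
      funext g j
      simp [component]
    exact this ▸ hx i
  · obtain ⟨i, hi⟩ := exists_candidate hP
    have hcand := binSystem_candidate s hi
    -- As the system of `P` is nonempty, so is that of any finite list of its candidates: the test
    -- never fails and all candidates are kept.
    have hQ : binSystem s (Q i) = binSystem s P := by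
      rw [← hcand]
      refine Set.Subset.antisymm (binSystem_mono s ?_) (binSystem_mono s ?_)
      · rintro p ⟨t, rfl⟩
        refine ⟨t + 1, mem_greedy_of_forall (fun l hl => (hfP l).1 ?_) t⟩
        exact (hcand ▸ hPne).mono (binSystem_mono s hl)
      · rintro p ⟨t, ht⟩
        exact exists_of_mem_greedy ht
    refine ⟨fun x => ⟨component i x.1, hQ ▸ (mem_binSystem_movePattern s).1 x.2 i⟩, ?_, ?_, ?_⟩
    · refine Continuous.subtype_mk (continuous_pi fun g => continuous_pi fun j => ?_) _
      exact (continuous_apply _).comp ((continuous_apply g).comp continuous_subtype_val)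
    -- Nonemptiness of the other components is what makes the projection surjective: they are filled
    -- with arbitrary points.
    · rintro ⟨z, hz⟩
      choose x hx using hne
      let w : ℕ → G → ℕ → Bool := fun k => if k = i then z else x k
      have hw : ∀ k, component k (fun g j => w j.unpair.1 g j.unpair.2) = w k := by
        intro k
        funext g j
        simp [component]
      refine ⟨⟨fun g j => w j.unpair.1 g j.unpair.2, (mem_binSystem_movePattern s).2 fun k => ?_⟩,
        Subtype.ext ?_⟩
      · rw [hw]
        by_cases hk : k = i
        · subst hk
          simpa [w, hQ] using hz
        · simpa [w, hk] using hx k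
      · exact (hw i).trans (if_pos rfl)
    · intro g x
      rfl

end Universal

theorem IsFactorMap.comp {G X Y Z : Type*} [Group G] [TopologicalSpace X] [TopologicalSpace Y]
    [TopologicalSpace Z] [MulAction G X] [MulAction G Y] [MulAction G Z] {g : Y → Z} {f : X → Y}
    (hg : IsFactorMap G g) (hf : IsFactorMap G f) : IsFactorMap G (g ∘ f) :=
  ⟨hg.1.comp hf.1, hg.2.1.comp hf.2.1, fun a x => by simp [hf.2.2, hg.2.2]⟩

/-! ### The two directions of the equivalence. -/

section Main

variable {G : Type*} [Group G] {n : ℕ} {s : Fin n → G}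

/-- Universality quantifies over spaces in `Type`, whereas `binSystem` lives in the universe of `G`;
the bit sequences give a copy in `Type`. -/
theorem isFactorMap_binHomeomorph (hs : Subgroup.closure (Set.range s) = ⊤)
    (P : BinPattern n → Prop) :
    @IsFactorMap G (binSet s P) (binSystem s P) _ _ _ (binSetAction P hs) _
      (binHomeomorph P hs) :=
  let _ := binSetAction P hs
  ⟨(binHomeomorph P hs).continuous, (binHomeomorph P hs).surjective, binHomeomorph_smul P hs⟩

/-- A single system serves both claims: it is zero-dimensional, yet factors onto every EDS. -/
theorem exists_universal_zeroDimEDS (hs : Subgroup.closure (Set.range s) = ⊤)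
    (hWP : DecidableWordProblem s) (hdom : DecidableDominoProblem s) :
    ∃ (U : Type) (_ : TopologicalSpace U) (_ : MulAction G U), Nonempty U ∧ IsZeroDimEDS G U ∧
      ∀ (X : Type) [TopologicalSpace X] [MulAction G X], Nonempty X → IsEDS G X →
        ∃ f : U → X, IsFactorMap G f := by
  obtain ⟨Q, hQ, hne, huniv⟩ := exists_universal_binSystem ((decidableDominoProblem_iff s).1 hdom)
  let _ := binSetAction Q hs
  refine ⟨binSet s Q, inferInstance, binSetAction Q hs, (hne.image _).to_subtype,
    isZeroDimEDS_binSet Q hs hWP hQ, fun X _ _ hX hEDS => ?_⟩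
  obtain ⟨P, hP, f, hf⟩ := hEDS.exists_binSystem_factor hs
  obtain ⟨x, -⟩ := hf.2.1 (Classical.choice hX)
  obtain ⟨g, hg⟩ := huniv P hP ⟨x.1, x.2⟩
  exact ⟨_, (hf.comp hg).comp (isFactorMap_binHomeomorph hs Q)⟩

/-- Being an EDS and factoring onto the zero-dimensional ones is common to both kinds of
universality. -/
theorem decidableDominoProblem_of_universal (hs : Subgroup.closure (Set.range s) = ⊤)
    (hWP : DecidableWordProblem s) {U : Type} [TopologicalSpace U] [MulAction G U]
    (hne : Nonempty U) (hU : IsEDS G U)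
    (huniv : ∀ (X : Type) [TopologicalSpace X] [MulAction G X], Nonempty X → IsZeroDimEDS G X →
      ∃ f : U → X, IsFactorMap G f) : DecidableDominoProblem s := by
  refine (decidableDominoProblem_iff s).2 (decidableBinaryDomino_of_factors hs hWP hU
    fun P hP => ?_)
  let _ := binSetAction (s := s) (· ∈ P) hs
  obtain ⟨f, hf⟩ := huniv (binSet s (· ∈ P)) (hP.image _).to_subtype
    (isZeroDimEDS_binSet _ hs hWP (REPred.mem (by fun_prop) (by fun_prop)))
  have := (isFactorMap_binHomeomorph hs (· ∈ P)).comp hf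
  exact ⟨_, this.1, this.2.2⟩

end Main

end EffDyn

theorem theoremB {G : Type*} [Group G] {n : ℕ} (s : Fin n → G)
    (hs : Subgroup.closure (Set.range s) = ⊤) (hWP : EffDyn.DecidableWordProblem s) :
    ((∃ (U : Type) (_ : TopologicalSpace U) (_ : MulAction G U), EffDyn.IsUniversalEDS G U) ↔
      EffDyn.DecidableDominoProblem s) ∧
    ((∃ (U : Type) (_ : TopologicalSpace U) (_ : MulAction G U),
        EffDyn.IsUniversalZeroDimEDS G U) ↔
      EffDyn.DecidableDominoProblem s) := by
  refine ⟨⟨?_, fun h => ?_⟩, ⟨?_, fun h => ?_⟩⟩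
  · rintro ⟨U, _, _, hne, hU, huniv⟩
    exact EffDyn.decidableDominoProblem_of_universal hs hWP hne hU
      fun X _ _ hX hEDS => huniv X hX hEDS.isEDS
  · obtain ⟨U, _, _, hne, hU, huniv⟩ := EffDyn.exists_universal_zeroDimEDS hs hWP h
    exact ⟨U, _, _, hne, hU.isEDS, huniv⟩
  · rintro ⟨U, _, _, hne, hU, huniv⟩
    exact EffDyn.decidableDominoProblem_of_universal hs hWP hne hU.isEDS huniv
  · obtain ⟨U, _, _, hne, hU, huniv⟩ := EffDyn.exists_universal_zeroDimEDS hs hWP h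
    exact ⟨U, _, _, hne, hU, fun X _ _ hX hEDS => huniv X hX hEDS.isEDS⟩
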